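/- **Model.** Let $d\ge 1$, $X_0\in\mathbb R^{n\times d}$, and let $a_{0i}\in\mathbb R^n$ ($i\ge1$) be nonrandom. One observes, for $i=1,\dots,m$, $$c_i=\begin{bmatrix}a_i\\ b_i\end{bmatrix}=\begin{bmatrix}a_{0i}\\ X_0^\top a_{0i}\end{bmatrix}+\tilde c_i\in\mathbb R^{n+d}.$$ For $X\in\mathbb R^{n\times d}$ put $Z(X)=\begin{bmatrix}X\\-\mathrm I_d\end{bmatrix}$; for a fixed $J\subset\{1,\dots,n+d\}$ let $Z_J(X)$ be the submatrix of the rows of $Z(X)$ with index in $J$. Let $A_0$ be the $m\times n$ matrix with rows $a_{0i}^\top$. Assume: 1. The random vectors $\tilde c_i=(\tilde c_{ij})_j$, $i\ge1$, are independent with zero mean and finite second moments. 2. $\mathsf E\tilde c_{ij}^2=0$ for all $i\ge 1$, $j\notin J$, and $\operatorname{cov}(\tilde c_{ij},j\in J)=\sigma^2\Sigma_i$ with $\sigma>0$ and known matrices $\Sigma_i$. 3. There is $\varkappa>0$ with $\lambda_{\min}(\Sigma_i)\ge\varkappa^2$ for all $i$. 4. $\operatorname{rank}Z_J(X_0)=d$.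 5. There is $r\ge2$ with $r>d\left(|J|-\frac{d+1}2\right)$ and $\sup_{i\ge1,\,j\in J}\mathsf E|\tilde c_{ij}|^{2r}<\infty$. 6. For some $\delta>0$, $\sup_{i\ge1,\,j\in J}\mathsf E|\tilde c_{ij}|^{4+2\delta}<\infty$ and $m^{-1-\delta/2}\sum_{i=1}^m\|a_{0i}\|^{2+\delta}\to0$ as $m\to\infty$. 7. $\frac1mA_0^\top A_0\to V_A$ as $m\to\infty$, where $V_A$ is nonsingular. 8. $\Sigma_i$ converges as $i\to\infty$. 9. $\mathsf E\,\tilde c_{ip}\tilde c_{iq}\tilde c_{ir}=0$ for all $i\ge1$ and $p,q,r\in J$. 10. For all $p,q,r,u\in J$, $\frac1m\sum_{i=1}^m\mathsf E\,\tilde c_{ip}\tilde c_{iq}\tilde c_{ir}\tilde c_{iu}$ converges to a finite limit as $m\to\infty$. **Estimator.** For each $m$, let $\hat X$ be an element-wise weighted total least squares estimator: a Borel map $C\mapsto\hat X(C)\in\mathbb R^{n\times d}\cup\{\infty\}$ of $m\times(n+d)$ data matrices $C=[A,B]$ such that $\hat X(C)$ is the $X$-component of a solution of $$\min_{X,\Delta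 A,\Delta B}\ \sum_{i=1}^m\big\|\Sigma_i^{-1/2}\Delta c_i^J\big\|^2\quad\text{subject to}\quad (A-\Delta A)X=B-\Delta B,\quad \Delta c_{ij}=0\ (j\notin J),\quad \operatorname{rank}Z_J(X)=d,$$ if a solution exists, and $\hat X(C)=\infty$ otherwise; here $[\Delta A,\Delta B]=(\Delta c_{ij})$ and $\Delta c_i^J=(\Delta c_{ij})_{j\in J}$. It is applied to the matrix $C$ with rows $c_1^\top,\dots,c_m^\top$. **Claim.** Let $S_i=\sigma^{-2}\operatorname{cov}(\tilde c_i)$, let a bar denote the average over $i=1,\dots,m$, let $\bar S_a$ be the upper left $n\times n$ block of $\bar S$, and, where $\hat X\ne\infty$, put $\hat Z=Z(\hat X)$ and $$\hat\sigma^2=\frac1d\operatorname{tr}\left[(\hat Z^\top\,\overline{cc^\top}\,\hat Z)(\hat Z^\top\bar S\hat Z)^{-1}\right],\qquad \hat V_A=\overline{aa^\top}-\hat\sigma^2\bar S_a.$$ Then $\hat\sigma^2\to\sigma^2$ and $\hat V_A\to V_A$ in probability as $m\to\infty$, in the sense that for every neighbourhood $U$ of the limit the probability that $\hat X=\infty$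 or that the statistic lies outside $U$ tends to $0$. -/

import Mathlib

open MeasureTheory ProbabilityTheory Filter Topology
open scoped ENNReal Matrix

namespace EWTLS

noncomputable section

/-- The `(n + d) × d` matrix `Z = Z(X)` with blocks `X` and `-I_d`. The coordinates of the rows
`c = (a, b)` are indexed by `Fin n ⊕ Fin d`. -/
def Z {n d : ℕ} (X : Matrix (Fin n) (Fin d) ℝ) : Matrix (Fin n ⊕ Fin d) (Fin d) ℝ :=
  Matrix.fromRows X (-1)

/-- The submatrix `Z_J` of the rows of `Z(X)` with index in `J`. -/
def ZJ {n d : ℕ} (J : Finset (Fin n ⊕ Fin d)) (X : Matrix (Fin n) (Fin d) ℝ) :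
    Matrix J (Fin d) ℝ :=
  (Z X).submatrix Subtype.val id

/-- The matrix with rows `x 0, …, x (m - 1)`. -/
def rowMatrix {ι : Type*} (m : ℕ) (x : ℕ → ι → ℝ) : Matrix (Fin m) ι ℝ :=
  Matrix.of fun i j => x i j

/-- The observed rows `c_i = (a_i, b_i) = (a_{0i}, X₀ᵀ a_{0i}) + c̃_i`; here `e i` is the error
vector `c̃_i`. -/
def obs {Ω : Type*} {n d : ℕ} (X₀ : Matrix (Fin n) (Fin d) ℝ) (a₀ : ℕ → Fin n → ℝ)
    (e : ℕ → Ω → (Fin n ⊕ Fin d → ℝ)) (ω : Ω) (i : ℕ) : Fin n ⊕ Fin d → ℝ :=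
  Sum.elim (a₀ i) (X₀ᵀ *ᵥ a₀ i) + e i ω

/-- The quadratic form `vᵀ M⁻¹ v`; it is `‖M^{-1/2} v‖²` for positive definite `M`
(see `weightedSq_eq_norm_sq`). -/
def weightedSq {ι : Type*} [Fintype ι] [DecidableEq ι] (M : Matrix ι ι ℝ) (v : ι → ℝ) : ℝ :=
  v ⬝ᵥ (M⁻¹ *ᵥ v)

theorem weightedSq_eq_norm_sq {ι : Type*} [Fintype ι] [DecidableEq ι] (M R : Matrix ι ι ℝ)
    (hR : R.IsSymm) (hRM : R * R = M⁻¹) (v : ι → ℝ) :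
    weightedSq M v = ‖WithLp.toLp 2 (R *ᵥ v)‖ ^ 2 := by
  rw [EuclideanSpace.real_norm_sq_eq, weightedSq, ← hRM, ← Matrix.mulVec_mulVec,
    Matrix.dotProduct_mulVec, ← Matrix.mulVec_transpose, hR.eq]
  simp [dotProduct, sq]

/-- The weighted sum of squared corrections `∑_i ‖Σ_i^{-1/2} Δc_i^J‖²`. -/
def cost {n d m : ℕ} (J : Finset (Fin n ⊕ Fin d)) (Sig : ℕ → Matrix J J ℝ)
    (ΔC : Matrix (Fin m) (Fin n ⊕ Fin d) ℝ) : ℝ :=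
  ∑ i : Fin m, weightedSq (Sig i) (fun j : J => ΔC i j)

/-- The constraints on `X` and `ΔC = [ΔA, ΔB]` for the data matrix `C = [A, B]`:
`(A - ΔA) X = B - ΔB`, `Δc_{ij} = 0` for `j ∉ J`, and `rank Z_J = d`. -/
def Feasible {n d m : ℕ} (J : Finset (Fin n ⊕ Fin d)) (C : Matrix (Fin m) (Fin n ⊕ Fin d) ℝ)
    (X : Matrix (Fin n) (Fin d) ℝ) (ΔC : Matrix (Fin m) (Fin n ⊕ Fin d) ℝ) : Prop :=
  (C.toCols₁ - ΔC.toCols₁) * X = C.toCols₂ - ΔC.toCols₂ ∧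
    (∀ i, ∀ j ∉ J, ΔC i j = 0) ∧ (ZJ J X).rank = d

/-- `X` is the `X`-component of a minimizer of the element-wise weighted total least squares
problem with data matrix `C`. -/
def Solves {n d m : ℕ} (J : Finset (Fin n ⊕ Fin d)) (Sig : ℕ → Matrix J J ℝ)
    (C : Matrix (Fin m) (Fin n ⊕ Fin d) ℝ) (X : Matrix (Fin n) (Fin d) ℝ) : Prop :=
  ∃ ΔC, Feasible J C X ΔC ∧ ∀ X' ΔC', Feasible J C X' ΔC' → cost J Sig ΔC ≤ cost J Sig ΔC'

/-- An EW-TLS estimator for `m` observations: a Borel map from data matrices to `ℝ^{n×d} ∪ {∞}`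
that returns a solution of the problem if there is one, and `∞` otherwise. -/
structure IsEstimator {n d m : ℕ} (J : Finset (Fin n ⊕ Fin d)) (Sig : ℕ → Matrix J J ℝ)
    (Xhat : Matrix (Fin m) (Fin n ⊕ Fin d) ℝ → OnePoint (Matrix (Fin n) (Fin d) ℝ)) : Prop where
  measurable : Measurable[borel _, borel _] Xhat
  solves : ∀ C (X : Matrix (Fin n) (Fin d) ℝ), Xhat C = (X : OnePoint (Matrix (Fin n) (Fin d) ℝ)) → Solves J Sig C X
  infty : ∀ C, Xhat C = OnePoint.infty → ¬ ∃ X, Solves J Sig C X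

/-- The matrix `S_i = σ⁻² cov(c̃_i)`. -/
def scaledCov {Ω : Type*} [MeasurableSpace Ω] {n d : ℕ} (P : Measure Ω) (σ : ℝ)
    (e : ℕ → Ω → (Fin n ⊕ Fin d → ℝ)) (i : ℕ) : Matrix (Fin n ⊕ Fin d) (Fin n ⊕ Fin d) ℝ :=
  Matrix.of fun p q => (1 / σ ^ 2) * covariance (fun ω => e i ω p) (fun ω => e i ω q) P

/-- The average of the first `m` members of a sequence of matrices. -/
def avg {ι κ : Type*} (m : ℕ) (M : ℕ → Matrix ι κ ℝ) : Matrix ι κ ℝ :=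
  (1 / (m : ℝ)) • ∑ i ∈ Finset.range m, M i

/-- `(1/d) tr[(Zᵀ (avg c cᵀ) Z) (Zᵀ S̄ Z)⁻¹]` at `Z = Z(X)`, from the rows `c` and matrices `S`. -/
def sigmaSq {n d : ℕ} (m : ℕ) (c : ℕ → Fin n ⊕ Fin d → ℝ)
    (S : ℕ → Matrix (Fin n ⊕ Fin d) (Fin n ⊕ Fin d) ℝ) (X : Matrix (Fin n) (Fin d) ℝ) : ℝ :=
  (1 / (d : ℝ)) * (((Z X)ᵀ * avg m (fun i => Matrix.vecMulVec (c i) (c i)) * Z X) *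
    ((Z X)ᵀ * avg m S * Z X)⁻¹).trace

/-- `(avg a aᵀ) - σ̂² S̄_a` at `X`, where `a_i` is the `n`-part of `c_i` and `S̄_a` is the upper left
`n × n` block of `S̄`. -/
def vA {n d : ℕ} (m : ℕ) (c : ℕ → Fin n ⊕ Fin d → ℝ)
    (S : ℕ → Matrix (Fin n ⊕ Fin d) (Fin n ⊕ Fin d) ℝ) (X : Matrix (Fin n) (Fin d) ℝ) :
    Matrix (Fin n) (Fin n) ℝ :=
  avg m (fun i => Matrix.vecMulVec (fun j => c i (Sum.inl j)) (fun j => c i (Sum.inl j)))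
    - sigmaSq m c S X • (avg m S).toBlocks₁₁

/-- Let `Xh m` be random elements of `𝕏 ∪ {∞}`. The statistics `f m ω (Xh m ω)`, defined where
`Xh m ω ≠ ∞`, converge in probability to `y`: for every neighbourhood `U` of `y`, the probability
that the statistic is undefined or lies outside `U` tends to zero. -/
def TendstoInProb {Ω 𝕏 E : Type*} [MeasurableSpace Ω] [TopologicalSpace E] (P : Measure Ω)
    (Xh : ℕ → Ω → OnePoint 𝕏) (f : ℕ → Ω → 𝕏 → E) (y : E) : Prop :=
  ∀ U ∈ 𝓝 y, Tendsto
    (fun m => P {ω | ¬ ∃ X : 𝕏, Xh m ω = (X : OnePoint 𝕏) ∧ f m ω X ∈ U}) atTop (𝓝 0)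

end

end EWTLS

/-! The heart of the matter is that `Xhat` is consistent; the two limits then follow by continuity.
Let `M` be the limit of the `Sig i`. It is positive definite because the lower eigenvalue bound is
uniform. Write `W = ZJ J X`. The constraint decouples over the rows: the corrections on `J` must
satisfy `Wᵀ w = (Z X)ᵀ c_i`, and the right side equals `(X - X₀)ᵀ a_i + Wᵀ z_i`, with `z_i` the
noise on `J`. Factor `Wᵀ M W = Rᵀ R`, put `T = R⁻¹`, `U = W T`, `Y = (X - X₀) T`. Then `Uᵀ M U = 1`,
and each row costs at least about `‖Yᵀ a_i + Uᵀ z_i‖²`.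

Averaging, the cross terms vanish, the noise contributes `d σ²` whatever `X` is, and the signal
contributes at least `l ‖Y‖²` with `l > 0` coming from `VA` (`mean_cost_ge`). At `X₀` an explicit
correction costs at most `d σ² + o(1)` on average (`exists_feasible_cost_le`). So any candidate at
least as good as this one has small `Y`, hence lies near `X₀`. The errors do not depend on `X`, so
the argument needs no prior bound on `X`. The same localization makes the problem effectively
compact and yields existence of a solution (`exists_solves_of_localized`); both conclusions meet in
`eventually_exists_solves_and_mem`.

All of this is deterministic and stated along an arbitrary filter. Convergence in probability
becomes convergence along `probFilter`, where the needed averages converge by the inequalities of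
Markov and Chebyshev and uniformly bounded fourth moments. Outer measure suffices there, so
auxiliary choices need not be measurable.

Finally `Z X₀` annihilates the signal part of the limit of `avg c cᵀ`, which leaves `σ²` times the
limit of the denominator of `sigmaSq`; subtracting the noise block then gives `VA`. -/

namespace EWTLS

noncomputable section

/-! ### Entrywise norms, quadratic forms and positive definite matrices. -/

section LinearAlgebra

variable {ι κ γ : Type*} [Fintype ι] [Fintype κ] [Fintype γ]

/-- The sum of the absolute values of the entries of a matrix. -/
def absSum (A : Matrix ι κ ℝ) : ℝ := ∑ p, ∑ q, |A p q|

/-- The squared Frobenius norm of a matrix. -/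
def frobSq (A : Matrix ι κ ℝ) : ℝ := ∑ p, ∑ q, A p q ^ 2

theorem absSum_nonneg (A : Matrix ι κ ℝ) : 0 ≤ absSum A :=
  Finset.sum_nonneg fun _ _ => Finset.sum_nonneg fun _ _ => abs_nonneg _

theorem frobSq_nonneg (A : Matrix ι κ ℝ) : 0 ≤ frobSq A :=
  Finset.sum_nonneg fun _ _ => Finset.sum_nonneg fun _ _ => sq_nonneg _

theorem continuous_absSum : Continuous (absSum : Matrix ι κ ℝ → ℝ) := by
  unfold absSum
  fun_prop

theorem continuous_frobSq : Continuous (frobSq : Matrix ι κ ℝ → ℝ) := by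
  unfold frobSq
  fun_prop

@[simp] theorem absSum_zero : absSum (0 : Matrix ι κ ℝ) = 0 := by simp [absSum]

@[simp] theorem frobSq_zero : frobSq (0 : Matrix ι κ ℝ) = 0 := by simp [frobSq]

theorem dotProduct_self_eq_sum_sq (v : ι → ℝ) : v ⬝ᵥ v = ∑ i, v i ^ 2 := by
  simp [dotProduct, sq]

theorem sq_le_dotProduct_self (v : ι → ℝ) (i : ι) : v i ^ 2 ≤ v ⬝ᵥ v := by
  rw [dotProduct_self_eq_sum_sq]
  exact Finset.single_le_sum (f := fun i => v i ^ 2) (fun _ _ => sq_nonneg _) (Finset.mem_univ i)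

theorem dotProduct_self_nonneg' (v : ι → ℝ) : 0 ≤ v ⬝ᵥ v := by
  rw [dotProduct_self_eq_sum_sq]
  positivity

theorem sq_le_frobSq (A : Matrix ι κ ℝ) (i : ι) (j : κ) : A i j ^ 2 ≤ frobSq A := by
  unfold frobSq
  exact (Finset.single_le_sum (f := fun j => A i j ^ 2) (fun _ _ => sq_nonneg _)
    (Finset.mem_univ j)).trans
    (Finset.single_le_sum (f := fun i => ∑ j, A i j ^ 2)
      (fun _ _ => Finset.sum_nonneg fun _ _ => sq_nonneg _) (Finset.mem_univ i))

theorem frobSq_eq_sum_col (A : Matrix ι κ ℝ) : frobSq A = ∑ j, A.col j ⬝ᵥ A.col j := by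
  simp_rw [dotProduct_self_eq_sum_sq]
  exact Finset.sum_comm

theorem dotProduct_sq_le (u v : ι → ℝ) : (u ⬝ᵥ v) ^ 2 ≤ (u ⬝ᵥ u) * (v ⬝ᵥ v) := by
  rw [dotProduct_self_eq_sum_sq, dotProduct_self_eq_sum_sq]
  exact Finset.sum_mul_sq_le_sq_mul_sq _ _ _

theorem frobSq_mul_le (A : Matrix ι κ ℝ) (B : Matrix κ γ ℝ) :
    frobSq (A * B) ≤ frobSq A * frobSq B := by
  have h : ∀ i j, (A * B) i j ^ 2 ≤ (∑ l, A i l ^ 2) * ∑ l, B l j ^ 2 := fun i j => by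
    rw [Matrix.mul_apply]
    exact Finset.sum_mul_sq_le_sq_mul_sq _ _ _
  calc frobSq (A * B) ≤ ∑ i, ∑ j, (∑ l, A i l ^ 2) * ∑ l, B l j ^ 2 :=
        Finset.sum_le_sum fun i _ => Finset.sum_le_sum fun j _ => h i j
    _ = frobSq A * frobSq B := by
        simp_rw [← Finset.mul_sum, ← Finset.sum_mul, frobSq]
        rw [Finset.sum_comm (f := fun l j => B l j ^ 2)]

theorem frobSq_add_le (A B : Matrix ι κ ℝ) : frobSq (A + B) ≤ 2 * (frobSq A + frobSq B) := by
  unfold frobSq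
  simp_rw [← Finset.sum_add_distrib, Finset.mul_sum]
  refine Finset.sum_le_sum fun i _ => Finset.sum_le_sum fun j _ => ?_
  rw [Matrix.add_apply]
  nlinarith [sq_nonneg (A i j - B i j)]

theorem mulVec_dotProduct_self_le (A : Matrix ι κ ℝ) (v : κ → ℝ) :
    (A *ᵥ v) ⬝ᵥ (A *ᵥ v) ≤ frobSq A * (v ⬝ᵥ v) := by
  rw [dotProduct_self_eq_sum_sq, dotProduct_self_eq_sum_sq, frobSq, Finset.sum_mul]
  exact Finset.sum_le_sum fun i _ => Finset.sum_mul_sq_le_sq_mul_sq _ _ _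

theorem two_abs_dotProduct_mulVec_le (A : Matrix ι κ ℝ) (u : ι → ℝ) (v : κ → ℝ) :
    2 * |u ⬝ᵥ (A *ᵥ v)| ≤ absSum A * (u ⬝ᵥ u + v ⬝ᵥ v) := by
  have h : u ⬝ᵥ (A *ᵥ v) = ∑ p, ∑ q, u p * (A p q * v q) := by
    simp [dotProduct, Matrix.mulVec, Finset.mul_sum]
  rw [h, absSum, Finset.sum_mul]
  refine (mul_le_mul_of_nonneg_left (Finset.abs_sum_le_sum_abs _ _) zero_le_two).trans ?_
  rw [Finset.mul_sum]
  refine Finset.sum_le_sum fun p _ => ?_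
  refine (mul_le_mul_of_nonneg_left (Finset.abs_sum_le_sum_abs _ _) zero_le_two).trans ?_
  rw [Finset.mul_sum, Finset.sum_mul]
  refine Finset.sum_le_sum fun q _ => ?_
  have h1 := sq_le_dotProduct_self u p
  have h2 := sq_le_dotProduct_self v q
  have h3 : 2 * (|u p| * |v q|) ≤ u ⬝ᵥ u + v ⬝ᵥ v := by
    nlinarith [sq_nonneg (|u p| - |v q|), sq_abs (u p), sq_abs (v q)]
  rw [abs_mul, abs_mul]
  nlinarith [abs_nonneg (A p q)]

theorem abs_quadForm_le (A : Matrix ι ι ℝ) (v : ι → ℝ) :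
    |v ⬝ᵥ (A *ᵥ v)| ≤ absSum A * (v ⬝ᵥ v) := by
  linarith [two_abs_dotProduct_mulVec_le A v v]

theorem posDef_transpose_mul_mul_of_rank {M : Matrix ι ι ℝ} (hM : M.PosDef) {W : Matrix ι κ ℝ}
    (hW : W.rank = Fintype.card κ) : (Wᵀ * M * W).PosDef := by
  have hinj : Function.Injective W.mulVec := by
    rw [Matrix.mulVec_injective_iff]
    rw [linearIndependent_iff_card_eq_finrank_span, ← hW, Matrix.rank_eq_finrank_span_cols]
    rfl
  simpa using hM.conjTranspose_mul_mul_same hinj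

/-- This turns full column rank into nonvanishing of a continuous function, so that it persists near
`X₀`. -/
theorem rank_eq_card_of_det_ne_zero [DecidableEq κ] {M : Matrix ι ι ℝ} {W : Matrix ι κ ℝ}
    (h : (Wᵀ * M * W).det ≠ 0) : W.rank = Fintype.card κ := by
  refine le_antisymm (Matrix.rank_le_card_width W) ?_
  rw [← Matrix.rank_of_isUnit _ ((Matrix.isUnit_iff_isUnit_det _).2 (isUnit_iff_ne_zero.2 h))]
  exact Matrix.rank_mul_le_right _ _

theorem posDef_of_quadForm_lower_bound {M : Matrix ι ι ℝ} (hs : M.IsSymm) {k : ℝ} (hk : 0 < k)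
    (h : ∀ v, k * (v ⬝ᵥ v) ≤ v ⬝ᵥ (M *ᵥ v)) : M.PosDef := by
  refine Matrix.PosDef.of_dotProduct_mulVec_pos (by simpa [Matrix.IsHermitian] using hs.eq)
    fun v hv => ?_
  have h1 : 0 < v ⬝ᵥ v :=
    lt_of_le_of_ne (dotProduct_self_nonneg' v) fun h0 => hv (dotProduct_self_eq_zero.1 h0.symm)
  simpa using (mul_pos hk h1).trans_le (h v)

variable [DecidableEq ι] [DecidableEq κ]

/-- Expand `0 ≤ (w - M v)ᵀ M⁻¹ (w - M v)`. Every test vector `v` thus bounds the weighted square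
from below without `M⁻¹`; the optimal choice is `v = M⁻¹ w`. -/
theorem two_dotProduct_sub_le_weightedSq {M : Matrix ι ι ℝ} (hM : M.PosDef) (w v : ι → ℝ) :
    2 * (w ⬝ᵥ v) - v ⬝ᵥ (M *ᵥ v) ≤ weightedSq M w := by
  have hs : Mᵀ = M := by simpa using hM.1.eq
  have hu : M⁻¹ * M = 1 := Matrix.nonsing_inv_mul M ((Matrix.isUnit_iff_isUnit_det M).1 hM.isUnit)
  have hu' : M * M⁻¹ = 1 := Matrix.mul_nonsing_inv M ((Matrix.isUnit_iff_isUnit_det M).1 hM.isUnit)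
  have h := hM.inv.posSemidef.dotProduct_mulVec_nonneg (w - M *ᵥ v)
  have h1 : M⁻¹ *ᵥ (M *ᵥ v) = v := by rw [Matrix.mulVec_mulVec, hu, Matrix.one_mulVec]
  have h2 : (M *ᵥ v) ⬝ᵥ (M⁻¹ *ᵥ w) = w ⬝ᵥ v := by
    rw [← hs, Matrix.mulVec_transpose, ← Matrix.dotProduct_mulVec, Matrix.mulVec_mulVec, hs, hu',
      Matrix.one_mulVec, dotProduct_comm]
  simp only [star_trivial, Matrix.mulVec_sub, h1, sub_dotProduct, dotProduct_sub, h2] at h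
  rw [dotProduct_comm (M *ᵥ v) v] at h
  unfold weightedSq
  linarith

theorem dotProduct_self_le_mul_weightedSq {M : Matrix ι ι ℝ} (hM : M.PosDef) {K : ℝ} (hK : 0 < K)
    (hMK : absSum M ≤ K) (w : ι → ℝ) : w ⬝ᵥ w ≤ K * weightedSq M w := by
  -- Since `M ≤ K` as a quadratic form, `K⁻¹ w` is the natural substitute for `M⁻¹ w`.
  have h := two_dotProduct_sub_le_weightedSq hM w (K⁻¹ • w)
  have h1 := (le_abs_self _).trans (abs_quadForm_le M w)
  have h2 := h1.trans (mul_le_mul_of_nonneg_right hMK (dotProduct_self_nonneg' w))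
  simp only [dotProduct_smul, Matrix.mulVec_smul, smul_dotProduct, smul_eq_mul] at h
  have h3 : K⁻¹ * (K⁻¹ * (w ⬝ᵥ (M *ᵥ w))) ≤ K⁻¹ * (w ⬝ᵥ w) := by
    refine mul_le_mul_of_nonneg_left ?_ (by positivity)
    rw [inv_mul_le_iff₀ hK]
    exact h2
  have h4 : K⁻¹ * (w ⬝ᵥ w) ≤ weightedSq M w := by linarith
  rwa [inv_mul_le_iff₀ hK] at h4

theorem exists_quadForm_lower_bound {M : Matrix ι ι ℝ} (hM : M.PosDef) :
    ∃ k : ℝ, 0 < k ∧ ∀ v, k * (v ⬝ᵥ v) ≤ v ⬝ᵥ (M *ᵥ v) := by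
  have hK : 0 < absSum M⁻¹ + 1 := by linarith [absSum_nonneg M⁻¹]
  refine ⟨(absSum M⁻¹ + 1)⁻¹, by positivity, fun v => ?_⟩
  have h := dotProduct_self_le_mul_weightedSq hM.inv hK (by linarith) v
  rw [weightedSq, Matrix.nonsing_inv_nonsing_inv _
    ((Matrix.isUnit_iff_isUnit_det M).1 hM.isUnit)] at h
  rwa [inv_mul_le_iff₀ hK]

theorem quadForm_lower_bound_of_spectrum {M : Matrix ι ι ℝ} (hs : M.IsSymm) {k : ℝ}
    (h : ∀ t ∈ spectrum ℝ M, k ≤ t) (v : ι → ℝ) : k * (v ⬝ᵥ v) ≤ v ⬝ᵥ (M *ᵥ v) := by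
  have hp : (M - algebraMap ℝ _ k).PosSemidef := by
    rw [Matrix.posSemidef_iff_isHermitian_and_spectrum_nonneg]
    refine ⟨?_, ?_⟩
    · have h1 : M.IsHermitian := by simpa [Matrix.IsHermitian] using hs.eq
      have h2 : (algebraMap ℝ (Matrix ι ι ℝ) k).IsHermitian := by
        rw [Matrix.algebraMap_eq_diagonal]
        exact Matrix.isHermitian_diagonal _
      exact h1.sub h2
    · rw [← spectrum.sub_singleton_eq]
      rintro _ ⟨t, ht, s, rfl, rfl⟩
      simpa using h t ht
  have h2 := hp.dotProduct_mulVec_nonneg v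
  rw [Matrix.sub_mulVec, Algebra.algebraMap_eq_smul_one, Matrix.smul_mulVec, Matrix.one_mulVec] at h2
  simpa using h2

/-- `R` is a square root of `P` up to a rotation, and `T` is its inverse. Multiplying columns by `T`
normalizes a Gram matrix equal to `P`; multiplying by `R` undoes it. -/
theorem exists_whitening {P : Matrix κ κ ℝ} (hP : P.PosDef) :
    ∃ T R : Matrix κ κ ℝ, T * R = 1 ∧ R * T = 1 ∧ P = Rᵀ * R := by
  open scoped MatrixOrder in
  obtain ⟨R, hR⟩ := CStarAlgebra.nonneg_iff_eq_star_mul_self.1 hP.posSemidef.nonneg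
  have hR' : P = Rᵀ * R := by simpa [Matrix.star_eq_conjTranspose] using hR
  have hu : IsUnit R.det := by
    have := hP.det_pos.ne'
    rw [hR', Matrix.det_mul, Matrix.det_transpose] at this
    exact isUnit_iff_ne_zero.2 (left_ne_zero_of_mul this)
  exact ⟨R⁻¹, R, Matrix.nonsing_inv_mul _ hu, Matrix.mul_nonsing_inv _ hu, hR'⟩

end LinearAlgebra

/-! ### Frobenius balls: compactness and neighbourhoods. -/

section Topology

variable {ι κ : Type*} [Fintype ι] [Fintype κ]

theorem isCompact_frobSq_sub_le (A : Matrix ι κ ℝ) (b : ℝ) :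
    IsCompact {X : Matrix ι κ ℝ | frobSq (X - A) ≤ b} := by
  have hc : IsCompact (Set.pi Set.univ fun i => Set.pi Set.univ fun j =>
      Set.Icc (A i j - (b + 1)) (A i j + (b + 1)) : Set (ι → κ → ℝ)) :=
    isCompact_univ_pi fun i => isCompact_univ_pi fun j => isCompact_Icc
  refine hc.of_isClosed_subset
    (isClosed_le (continuous_frobSq.comp (continuous_id.sub continuous_const)) continuous_const) ?_
  intro (X : Matrix ι κ ℝ) hX i _ j _
  have h1 : (X - A) i j ^ 2 ≤ b := (sq_le_frobSq (X - A) i j).trans hX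
  rw [Matrix.sub_apply] at h1
  have hb : 0 ≤ b := (sq_nonneg _).trans h1
  -- The crude radius `b + 1` avoids a square root: `b ≤ (b + 1) ^ 2`.
  have h2 : |X i j - A i j| ≤ b + 1 := abs_le_of_sq_le_sq (by nlinarith) (by linarith)
  rw [abs_le] at h2
  constructor <;> linarith [h2.1, h2.2]

theorem exists_frobSq_sub_le_imp_mem {A : Matrix ι κ ℝ} {U : Set (Matrix ι κ ℝ)} (hU : U ∈ 𝓝 A) :
    ∃ η : ℝ, 0 < η ∧ ∀ X, frobSq (X - A) ≤ η → X ∈ U := by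
  obtain ⟨r, hr, hrU⟩ := (Metric.mem_nhds_iff (α := ι → κ → ℝ) (x := A) (s := U)).1 hU
  refine ⟨(r / 2) ^ 2, by positivity, fun X hX => hrU ?_⟩
  refine (dist_pi_lt_iff hr).2 fun i => ?_
  refine (dist_pi_lt_iff hr).2 fun j => ?_
  have h1 : |(X - A) i j| ≤ r / 2 :=
    abs_le_of_sq_le_sq ((sq_le_frobSq (X - A) i j).trans hX) (by positivity)
  rw [Matrix.sub_apply] at h1
  rw [Real.dist_eq]
  linarith

end Topology

/-! ### Averages and a lower bound for averaged squared residuals. -/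

section Averages

variable {ι κ γ : Type*}

/-- The average of the first `m` members of a sequence of numbers. -/
def mean (m : ℕ) (f : ℕ → ℝ) : ℝ := (1 / (m : ℝ)) * ∑ i ∈ Finset.range m, f i

theorem mean_add (m : ℕ) (f g : ℕ → ℝ) : mean m (fun i => f i + g i) = mean m f + mean m g := by
  simp [mean, Finset.sum_add_distrib, mul_add]

theorem mean_sub (m : ℕ) (f g : ℕ → ℝ) : mean m (fun i => f i - g i) = mean m f - mean m g := by
  simp [mean, mul_sub]

theorem mean_const_mul (m : ℕ) (r : ℝ) (f : ℕ → ℝ) : mean m (fun i => r * f i) = r * mean m f := by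
  simp [mean, ← Finset.mul_sum, mul_left_comm]

theorem mean_sum {s : Finset γ} (m : ℕ) (f : γ → ℕ → ℝ) :
    mean m (fun i => ∑ j ∈ s, f j i) = ∑ j ∈ s, mean m (f j) := by
  simp only [mean]
  rw [Finset.sum_comm, Finset.mul_sum]

theorem mean_le_mean {m : ℕ} {f g : ℕ → ℝ} (h : ∀ i < m, f i ≤ g i) : mean m f ≤ mean m g :=
  mul_le_mul_of_nonneg_left (Finset.sum_le_sum fun i hi => h i (Finset.mem_range.1 hi))
    (by positivity)

theorem mean_nonneg {m : ℕ} {f : ℕ → ℝ} (h : ∀ i, 0 ≤ f i) : 0 ≤ mean m f :=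
  mul_nonneg (by positivity) (Finset.sum_nonneg fun i _ => h i)

theorem avg_apply (m : ℕ) (M : ℕ → Matrix ι κ ℝ) (p : ι) (q : κ) :
    avg m M p q = mean m (fun i => M i p q) := by
  simp [avg, mean, Matrix.sum_apply]

variable [Fintype ι] [Fintype κ] [Fintype γ]

theorem dotProduct_avg_mulVec (m : ℕ) (x : ℕ → ι → ℝ) (y : ℕ → κ → ℝ) (u : ι → ℝ) (v : κ → ℝ) :
    u ⬝ᵥ (avg m (fun i => Matrix.vecMulVec (x i) (y i)) *ᵥ v) =
      mean m (fun i => (u ⬝ᵥ x i) * (v ⬝ᵥ y i)) := by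
  simp only [avg, mean, Matrix.smul_mulVec, dotProduct_smul, Matrix.sum_mulVec, dotProduct_sum,
    smul_eq_mul]
  congr 1
  refine Finset.sum_congr rfl fun i _ => ?_
  rw [Matrix.vecMulVec_mulVec, dotProduct_comm (y i) v]
  simp [mul_comm]

/-- The relative error of the lower bound for the averaged weighted residuals, multiplying the squared
size of the signal. -/
def signalErr (m : ℕ) (k : ℝ) (a : ℕ → κ → ℝ) (x : ℕ → ι → ℝ) (ε : ℕ → ℝ) (V : Matrix κ κ ℝ) : ℝ :=
  absSum (avg m (fun i => Matrix.vecMulVec (a i) (a i)) - V) +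
    absSum (avg m fun i => Matrix.vecMulVec (a i) (x i)) +
    2 / k * mean m (fun i => ε i * (a i ⬝ᵥ a i))

/-- The error of the averaged squared weighted residuals that does not depend on the signal. -/
def noiseErr (m : ℕ) (k : ℝ) (a : ℕ → κ → ℝ) (x : ℕ → ι → ℝ) (ε : ℕ → ℝ) (N : Matrix ι ι ℝ) : ℝ :=
  (absSum (avg m fun i => Matrix.vecMulVec (a i) (x i)) +
    absSum (avg m (fun i => Matrix.vecMulVec (x i) (x i)) - N) +
    2 / k * mean m (fun i => ε i * (x i ⬝ᵥ x i))) / k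

/-- Expanding the square, the signal term is controlled by `V`, the noise term is close to `σ ^ 2`
by the normalization `hu`, and the cross term is split evenly between `y` and `u`. The weights may
be negative for small `i`; this is harmless because their deviation from one is only estimated on
average. -/
theorem mean_weighted_sq_ge (m : ℕ) (a : ℕ → κ → ℝ) (x : ℕ → ι → ℝ) (ε : ℕ → ℝ)
    (hε : ∀ i, 0 ≤ ε i) {V : Matrix κ κ ℝ} {M : Matrix ι ι ℝ} {k l σ : ℝ} (hk : 0 < k)
    (hl : ∀ v, l * (v ⬝ᵥ v) ≤ v ⬝ᵥ (V *ᵥ v)) (y : κ → ℝ) (u : ι → ℝ)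
    (hu : u ⬝ᵥ (M *ᵥ u) = 1) (huk : u ⬝ᵥ u ≤ 1 / k) :
    σ ^ 2 + (l - signalErr m k a x ε V) * (y ⬝ᵥ y) - noiseErr m k a x ε (σ ^ 2 • M) ≤
      mean m (fun i => (1 - ε i / k) * (y ⬝ᵥ a i + u ⬝ᵥ x i) ^ 2) := by
  set A := avg m (fun i => Matrix.vecMulVec (a i) (a i)) with hA
  set B := avg m (fun i => Matrix.vecMulVec (a i) (x i)) with hB
  set E := avg m (fun i => Matrix.vecMulVec (x i) (x i)) with hE
  set ra := mean m (fun i => ε i * (a i ⬝ᵥ a i)) with hra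
  set rx := mean m (fun i => ε i * (x i ⬝ᵥ x i)) with hrx
  have hy0 := dotProduct_self_nonneg' y
  have hu0 := dotProduct_self_nonneg' u
  have h1 : mean m (fun i => (y ⬝ᵥ a i + u ⬝ᵥ x i) ^ 2) =
      y ⬝ᵥ (A *ᵥ y) + 2 * (y ⬝ᵥ (B *ᵥ u)) + u ⬝ᵥ (E *ᵥ u) := by
    rw [hA, hB, hE, dotProduct_avg_mulVec, dotProduct_avg_mulVec, dotProduct_avg_mulVec,
      ← mean_const_mul, ← mean_add, ← mean_add]
    congr 1
    funext i
    ring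
  have h2 : mean m (fun i => ε i / k * (y ⬝ᵥ a i + u ⬝ᵥ x i) ^ 2) ≤
      2 / k * ra * (y ⬝ᵥ y) + 2 / k * rx * (u ⬝ᵥ u) := by
    have : 2 / k * ra * (y ⬝ᵥ y) + 2 / k * rx * (u ⬝ᵥ u) =
        mean m (fun i => (2 / k * (y ⬝ᵥ y)) * (ε i * (a i ⬝ᵥ a i)) +
          (2 / k * (u ⬝ᵥ u)) * (ε i * (x i ⬝ᵥ x i))) := by
      rw [mean_add, mean_const_mul, mean_const_mul]
      ring
    rw [this]
    refine mean_le_mean fun i _ => ?_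
    have h3 := dotProduct_sq_le y (a i)
    have h4 := dotProduct_sq_le u (x i)
    have h5 : (y ⬝ᵥ a i + u ⬝ᵥ x i) ^ 2 ≤
        2 * ((y ⬝ᵥ y) * (a i ⬝ᵥ a i)) + 2 * ((u ⬝ᵥ u) * (x i ⬝ᵥ x i)) := by
      nlinarith [sq_nonneg (y ⬝ᵥ a i - u ⬝ᵥ x i)]
    have h6 : 0 ≤ ε i / k := div_nonneg (hε i) hk.le
    calc ε i / k * (y ⬝ᵥ a i + u ⬝ᵥ x i) ^ 2 ≤ ε i / k *
          (2 * ((y ⬝ᵥ y) * (a i ⬝ᵥ a i)) + 2 * ((u ⬝ᵥ u) * (x i ⬝ᵥ x i))) :=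
          mul_le_mul_of_nonneg_left h5 h6
      _ = _ := by ring
  have h3 : mean m (fun i => (1 - ε i / k) * (y ⬝ᵥ a i + u ⬝ᵥ x i) ^ 2) =
      mean m (fun i => (y ⬝ᵥ a i + u ⬝ᵥ x i) ^ 2) -
        mean m (fun i => ε i / k * (y ⬝ᵥ a i + u ⬝ᵥ x i) ^ 2) := by
    rw [← mean_sub]
    congr 1
    funext i
    ring
  have h4 : (l - absSum (A - V)) * (y ⬝ᵥ y) ≤ y ⬝ᵥ (A *ᵥ y) := by
    have := (abs_le.1 (abs_quadForm_le (A - V) y)).1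
    rw [Matrix.sub_mulVec, dotProduct_sub] at this
    linarith [hl y]
  have h5 : -(absSum B * (y ⬝ᵥ y + u ⬝ᵥ u)) ≤ 2 * (y ⬝ᵥ (B *ᵥ u)) := by
    have := two_abs_dotProduct_mulVec_le B y u
    linarith [neg_abs_le (y ⬝ᵥ (B *ᵥ u))]
  have h6 : σ ^ 2 - absSum (E - σ ^ 2 • M) * (u ⬝ᵥ u) ≤ u ⬝ᵥ (E *ᵥ u) := by
    have := (abs_le.1 (abs_quadForm_le (E - σ ^ 2 • M) u)).1
    rw [Matrix.sub_mulVec, dotProduct_sub, Matrix.smul_mulVec, dotProduct_smul, hu,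
      smul_eq_mul] at this
    linarith
  have hrx0 : 0 ≤ 2 / k * rx :=
    mul_nonneg (by positivity) (mean_nonneg fun i => mul_nonneg (hε i) (dotProduct_self_nonneg' _))
  have h7 : (absSum B + absSum (E - σ ^ 2 • M) + 2 / k * rx) * (u ⬝ᵥ u) ≤
      (absSum B + absSum (E - σ ^ 2 • M) + 2 / k * rx) * (1 / k) :=
    mul_le_mul_of_nonneg_left huk
      (add_nonneg (add_nonneg (absSum_nonneg _) (absSum_nonneg _)) hrx0)
  rw [h3, h1]
  unfold signalErr noiseErr
  rw [← hA, ← hB, ← hE, ← hra, ← hrx, div_eq_mul_one_div (_ + _ + _) k]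
  nlinarith [h2, h4, h5, h6, h7]

end Averages

/-! ### The constraint written row by row. -/

section Rows

variable {n d m : ℕ} {J : Finset (Fin n ⊕ Fin d)}

theorem transpose_Z_mulVec_of_eq_zero (X : Matrix (Fin n) (Fin d) ℝ) (v : Fin n ⊕ Fin d → ℝ)
    (hv : ∀ j ∉ J, v j = 0) : (Z X)ᵀ *ᵥ v = (ZJ J X)ᵀ *ᵥ (fun j : J => v j) := by
  funext l
  simp only [Matrix.mulVec, dotProduct, Matrix.transpose_apply, ZJ, Matrix.submatrix_apply, id]
  refine Eq.trans ?_ (Finset.sum_coe_sort J fun j => Z X j l * v j).symm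
  exact (Finset.sum_subset (Finset.subset_univ J) fun j _ hj => by rw [hv j hj, mul_zero]).symm

theorem transpose_Z_mulVec_signal (X X₀ : Matrix (Fin n) (Fin d) ℝ) (a : Fin n → ℝ) :
    (Z X)ᵀ *ᵥ (Sum.elim a (X₀ᵀ *ᵥ a)) = (X - X₀)ᵀ *ᵥ a := by
  rw [Z, Matrix.transpose_fromRows, Matrix.fromCols_mulVec, Matrix.transpose_sub, Matrix.sub_mulVec]
  simp [Function.comp_def, Matrix.neg_mulVec, sub_eq_add_neg]

/-- The constraint says `(C - ΔC) Z(X) = 0`, and only the entries in `J` of a correction survive.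
Hence the problem splits into independent linear equations for the rows once `X` is fixed. -/
theorem feasible_iff {C : Matrix (Fin m) (Fin n ⊕ Fin d) ℝ} {X : Matrix (Fin n) (Fin d) ℝ}
    {ΔC : Matrix (Fin m) (Fin n ⊕ Fin d) ℝ} (h0 : ∀ i, ∀ j ∉ J, ΔC i j = 0) :
    (C.toCols₁ - ΔC.toCols₁) * X = C.toCols₂ - ΔC.toCols₂ ↔
      ∀ i, (ZJ J X)ᵀ *ᵥ (fun j : J => ΔC i j) = (Z X)ᵀ *ᵥ C i := by
  have h1 : (C - ΔC) * Z X = (C.toCols₁ - ΔC.toCols₁) * X - (C.toCols₂ - ΔC.toCols₂) := by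
    have h2 : C - ΔC = Matrix.fromCols (C.toCols₁ - ΔC.toCols₁) (C.toCols₂ - ΔC.toCols₂) := by
      ext i (j | j) <;> rfl
    rw [h2, Z, Matrix.fromCols_mul_fromRows]
    simp [sub_eq_add_neg]
  rw [← sub_eq_zero, ← h1, Matrix.sub_mul, sub_eq_zero]
  constructor
  · intro h i
    rw [← transpose_Z_mulVec_of_eq_zero X _ (h0 i)]
    funext l
    have := congrFun (congrFun h i) l
    simp only [Matrix.mul_apply] at this
    simp only [Matrix.mulVec, dotProduct, Matrix.transpose_apply]
    simp_rw [mul_comm (Z X _ l)]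
    exact this.symm
  · intro h
    ext i l
    have := congrFun (h i) l
    rw [← transpose_Z_mulVec_of_eq_zero X _ (h0 i)] at this
    simp only [Matrix.mulVec, dotProduct, Matrix.transpose_apply] at this
    simp only [Matrix.mul_apply]
    simp_rw [mul_comm _ (Z X _ l)]
    exact this.symm

theorem frobSq_ZJ_le (X X₀ : Matrix (Fin n) (Fin d) ℝ) :
    frobSq (ZJ J X) ≤ 2 * (frobSq (ZJ J X₀) + frobSq (X - X₀)) := by
  have h1 : frobSq (ZJ J X - ZJ J X₀) ≤ frobSq (X - X₀) := by
    have h2 : frobSq (Z X - Z X₀) = frobSq (X - X₀) := by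
      simp [frobSq, Z, Fintype.sum_sum_type]
    rw [← h2]
    exact (Finset.sum_coe_sort J fun p => ∑ q, (Z X - Z X₀) p q ^ 2).le.trans
      (Finset.sum_le_univ_sum_of_nonneg fun _ => Finset.sum_nonneg fun _ _ => sq_nonneg _)
  have h2 := frobSq_add_le (ZJ J X₀) (ZJ J X - ZJ J X₀)
  rw [add_sub_cancel] at h2
  linarith

end Rows

/-! ### Normalized columns and the cost of one row. -/

section Whitening

variable {ι κ : Type*} [Fintype ι]

theorem col_dotProduct_mulVec_col (U : Matrix ι κ ℝ) (M : Matrix ι ι ℝ) (j : κ) :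
    U.col j ⬝ᵥ (M *ᵥ U.col j) = (Uᵀ * M * U) j j := by
  rw [Matrix.mul_assoc, Matrix.mul_apply']
  rfl

theorem col_dotProduct_self_le [DecidableEq κ] {U : Matrix ι κ ℝ} {M : Matrix ι ι ℝ} {k : ℝ} (hk : 0 < k)
    (hMk : ∀ v, k * (v ⬝ᵥ v) ≤ v ⬝ᵥ (M *ᵥ v)) (hU : Uᵀ * M * U = 1) (j : κ) :
    U.col j ⬝ᵥ U.col j ≤ 1 / k := by
  have h := hMk (U.col j)
  rw [col_dotProduct_mulVec_col, hU, Matrix.one_apply_eq] at h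
  rwa [le_div_iff₀ hk, mul_comm]

variable [Fintype κ]

theorem mulVec_dotProduct_mulVec_mulVec (U : Matrix ι κ ℝ) (M : Matrix ι ι ℝ) (s : κ → ℝ) :
    (U *ᵥ s) ⬝ᵥ (M *ᵥ (U *ᵥ s)) = s ⬝ᵥ ((Uᵀ * M * U) *ᵥ s) := by
  rw [Matrix.mul_assoc, ← Matrix.mulVec_mulVec, Matrix.dotProduct_mulVec s, Matrix.vecMul_transpose,
    Matrix.mulVec_mulVec]

variable [DecidableEq κ]

theorem whitened_gram {P T R : Matrix κ κ ℝ} {W : Matrix ι κ ℝ} {M : Matrix ι ι ℝ} (hRT : R * T = 1)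
    (hP : P = Rᵀ * R) (hPW : P = Wᵀ * M * W) : (W * T)ᵀ * M * (W * T) = 1 := by
  have h1 : (W * T)ᵀ * M * (W * T) = Tᵀ * (Wᵀ * M * W) * T := by
    rw [Matrix.transpose_mul]
    simp only [Matrix.mul_assoc]
  rw [h1, ← hPW, hP, ← Matrix.mul_assoc, ← Matrix.transpose_mul, hRT, Matrix.transpose_one,
    Matrix.one_mul, hRT]

/-- Use the test vector `U Uᵀ w`, which would give exactly `‖Uᵀ w‖²` if `S` were `M`. The bound sees
`w` only through `Uᵀ w`, which the constraint determines. -/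
theorem weightedSq_ge_of_whitened [DecidableEq ι] {S M : Matrix ι ι ℝ} (hS : S.PosDef) {k : ℝ}
    (hk : 0 < k) (hMk : ∀ v, k * (v ⬝ᵥ v) ≤ v ⬝ᵥ (M *ᵥ v)) {U : Matrix ι κ ℝ}
    (hU : Uᵀ * M * U = 1) (w : ι → ℝ) :
    (1 - absSum (S - M) / k) * ((Uᵀ *ᵥ w) ⬝ᵥ (Uᵀ *ᵥ w)) ≤ weightedSq S w := by
  set s := Uᵀ *ᵥ w with hs
  have h1 := two_dotProduct_sub_le_weightedSq hS w (U *ᵥ s)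
  have h2 : w ⬝ᵥ (U *ᵥ s) = s ⬝ᵥ s := by
    rw [Matrix.dotProduct_mulVec, ← Matrix.mulVec_transpose]
  have h3 : (U *ᵥ s) ⬝ᵥ (M *ᵥ (U *ᵥ s)) = s ⬝ᵥ s := by
    rw [mulVec_dotProduct_mulVec_mulVec, hU, Matrix.one_mulVec]
  have h4 := (abs_le.1 (abs_quadForm_le (S - M) (U *ᵥ s))).2
  rw [Matrix.sub_mulVec, dotProduct_sub, h3] at h4
  have h5 := hMk (U *ᵥ s)
  rw [h3] at h5
  have h6 : absSum (S - M) * ((U *ᵥ s) ⬝ᵥ (U *ᵥ s)) ≤ absSum (S - M) / k * (s ⬝ᵥ s) := by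
    rw [div_mul_eq_mul_div, mul_div_assoc]
    refine mul_le_mul_of_nonneg_left ?_ (absSum_nonneg _)
    rwa [le_div_iff₀ hk, mul_comm]
  rw [h2] at h1
  linarith

end Whitening

/-! ### Two-sided control of the cost and existence of minimizers. -/

section Cost

variable {n d : ℕ} {J : Finset (Fin n ⊕ Fin d)}

/-- The rows `(a_i, X₀ᵀ a_i) + x_i`. -/
def noisyRows (X₀ : Matrix (Fin n) (Fin d) ℝ) (a : ℕ → Fin n → ℝ) (x : ℕ → Fin n ⊕ Fin d → ℝ)
    (i : ℕ) : Fin n ⊕ Fin d → ℝ :=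
  Sum.elim (a i) (X₀ᵀ *ᵥ a i) + x i

/-- The subvectors of the members of a sequence with indices in `J`. -/
def restr (J : Finset (Fin n ⊕ Fin d)) (x : ℕ → Fin n ⊕ Fin d → ℝ) (i : ℕ) (j : J) : ℝ := x i j

theorem transpose_Z_mulVec_noisyRows {x : ℕ → Fin n ⊕ Fin d → ℝ} {i : ℕ}
    (hx : ∀ j ∉ J, x i j = 0) (X₀ X : Matrix (Fin n) (Fin d) ℝ) (a : ℕ → Fin n → ℝ) :
    (Z X)ᵀ *ᵥ noisyRows X₀ a x i = (X - X₀)ᵀ *ᵥ a i + (ZJ J X)ᵀ *ᵥ restr J x i := by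
  rw [noisyRows, Matrix.mulVec_add, transpose_Z_mulVec_signal, transpose_Z_mulVec_of_eq_zero X _ hx]
  rfl

/-- Apply the row bound with the whitened `U = W T` and sum the averages over the `d` columns. Here
`y` is `frobSq Y` for `Y = (X - X₀) T`. Undoing the whitening costs a factor `frobSq R`, the trace
of `Wᵀ M W`, which grows at most like `1 + frobSq (X - X₀)`; for small `y` this growth can be
absorbed. -/
theorem mean_cost_ge {Sig : ℕ → Matrix J J ℝ} (hSig : ∀ i, (Sig i).PosDef) {M : Matrix J J ℝ}
    (hM : M.PosDef) {k l σ : ℝ} (hk : 0 < k) (hMk : ∀ v, k * (v ⬝ᵥ v) ≤ v ⬝ᵥ (M *ᵥ v))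
    {V : Matrix (Fin n) (Fin n) ℝ} (hl : ∀ v, l * (v ⬝ᵥ v) ≤ v ⬝ᵥ (V *ᵥ v))
    {x : ℕ → Fin n ⊕ Fin d → ℝ} {m : ℕ} (hx : ∀ i, ∀ j ∉ J, x i j = 0)
    {X₀ X : Matrix (Fin n) (Fin d) ℝ} {a : ℕ → Fin n → ℝ}
    {ΔC : Matrix (Fin m) (Fin n ⊕ Fin d) ℝ}
    (hF : Feasible J (rowMatrix m (noisyRows X₀ a x)) X ΔC) :
    ∃ y : ℝ, 0 ≤ y ∧
      frobSq (X - X₀) ≤ y * (2 * absSum M * (frobSq (ZJ J X₀) + frobSq (X - X₀))) ∧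
      d * σ ^ 2 + (l - signalErr m k a (restr J x) (fun i => absSum (Sig i - M)) V) * y
        - d * noiseErr m k a (restr J x) (fun i => absSum (Sig i - M)) (σ ^ 2 • M) ≤
      1 / (m : ℝ) * cost J Sig ΔC := by
  obtain ⟨hF1, hF2, hF3⟩ := hF
  rw [feasible_iff hF2] at hF1
  have hP := posDef_transpose_mul_mul_of_rank hM (W := ZJ J X) (by simpa using hF3)
  obtain ⟨T, R, hTR, hRT, hPR⟩ := exists_whitening hP
  set W := ZJ J X with hW
  set U := W * T with hUdef
  set Y := (X - X₀) * T with hYdef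
  have hU : Uᵀ * M * U = 1 := whitened_gram hRT hPR rfl
  refine ⟨frobSq Y, frobSq_nonneg _, ?_, ?_⟩
  · have h1 : frobSq (X - X₀) ≤ frobSq Y * frobSq R := by
      have : X - X₀ = Y * R := by rw [hYdef, Matrix.mul_assoc, hTR, Matrix.mul_one]
      conv_lhs => rw [this]
      exact frobSq_mul_le _ _
    have h2 : frobSq R ≤ absSum M * frobSq W := by
      rw [frobSq_eq_sum_col, frobSq_eq_sum_col, Finset.mul_sum]
      refine Finset.sum_le_sum fun j _ => ?_
      have h3 := (abs_le.1 (abs_quadForm_le M (W.col j))).2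
      rw [col_dotProduct_mulVec_col, hPR, Matrix.mul_apply'] at h3
      exact h3
    have h3 := mul_le_mul_of_nonneg_left (frobSq_ZJ_le (J := J) X X₀) (absSum_nonneg M)
    refine h1.trans (mul_le_mul_of_nonneg_left ?_ (frobSq_nonneg _))
    linarith
  · set ε : ℕ → ℝ := fun i => absSum (Sig i - M) with hε
    have h1 : ∀ i : Fin m, ∑ j, (1 - ε i / k) *
        (Y.col j ⬝ᵥ a i + U.col j ⬝ᵥ restr J x i) ^ 2 ≤
        weightedSq (Sig i) (fun j : J => ΔC i j) := by
      intro i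
      refine le_trans (le_of_eq ?_)
        (weightedSq_ge_of_whitened (hSig i) hk hMk hU (fun j : J => ΔC i j))
      have h2 : Uᵀ *ᵥ (fun j : J => ΔC i j) = Yᵀ *ᵥ a i + Uᵀ *ᵥ restr J x i := by
        rw [hUdef, hYdef, Matrix.transpose_mul, Matrix.transpose_mul, ← Matrix.mulVec_mulVec, hF1 i,
          ← Matrix.mulVec_mulVec, ← Matrix.mulVec_mulVec, ← Matrix.mulVec_add,
          ← transpose_Z_mulVec_noisyRows (hx i)]
        rfl
      rw [h2, dotProduct_self_eq_sum_sq, Finset.mul_sum]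
      rfl
    have h2 : mean m (fun i => ∑ j, (1 - ε i / k) *
        (Y.col j ⬝ᵥ a i + U.col j ⬝ᵥ restr J x i) ^ 2) ≤ 1 / (m : ℝ) * cost J Sig ΔC := by
      refine mul_le_mul_of_nonneg_left ?_ (by positivity)
      rw [← Fin.sum_univ_eq_sum_range]
      exact Finset.sum_le_sum fun i _ => h1 i
    refine le_trans ?_ h2
    rw [mean_sum (f := fun j i => (1 - ε i / k) *
      (Y.col j ⬝ᵥ a i + U.col j ⬝ᵥ restr J x i) ^ 2)]
    refine le_trans (le_of_eq ?_) (Finset.sum_le_sum fun j _ =>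
      mean_weighted_sq_ge (σ := σ) m a (restr J x) ε (fun i => absSum_nonneg _) hk hl (Y.col j)
        (U.col j) (M := M) (by rw [col_dotProduct_mulVec_col, hU, Matrix.one_apply_eq])
        (col_dotProduct_self_le hk hMk hU j))
    rw [Finset.sum_sub_distrib, Finset.sum_add_distrib, ← Finset.mul_sum, ← frobSq_eq_sum_col]
    simp

/-- For the limiting weight `M` the cheapest correction of row `i` at `X₀` is `M U Uᵀ z_i`, of cost
`‖Uᵀ z_i‖²`. Replacing `M⁻¹` by `(Sig i)⁻¹` produces the last error term; `K` depends on neither the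
noise nor `m`. -/
theorem exists_feasible_cost_le {M : Matrix J J ℝ} (hM : M.PosDef) {k : ℝ} (hk : 0 < k)
    (hMk : ∀ v, k * (v ⬝ᵥ v) ≤ v ⬝ᵥ (M *ᵥ v)) (σ : ℝ) {X₀ : Matrix (Fin n) (Fin d) ℝ}
    (hX₀ : (ZJ J X₀).rank = d) (Sig : ℕ → Matrix J J ℝ) (a : ℕ → Fin n → ℝ) :
    ∃ K : ℝ, ∀ (x : ℕ → Fin n ⊕ Fin d → ℝ) (m : ℕ), (∀ i, ∀ j ∉ J, x i j = 0) →
      ∃ ΔC, Feasible J (rowMatrix m (noisyRows X₀ a x)) X₀ ΔC ∧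
        1 / (m : ℝ) * cost J Sig ΔC ≤ d * σ ^ 2 +
          (d / k * absSum (avg m (fun i => Matrix.vecMulVec (restr J x i) (restr J x i)) - σ ^ 2 • M)
          + K * mean m fun i => absSum ((Sig i)⁻¹ - M⁻¹) * (restr J x i ⬝ᵥ restr J x i)) := by
  have hP := posDef_transpose_mul_mul_of_rank hM (W := ZJ J X₀) (by simpa using hX₀)
  obtain ⟨T, R, hTR, hRT, hPR⟩ := exists_whitening hP
  set W := ZJ J X₀ with hW
  set U := W * T with hUdef
  have hU : Uᵀ * M * U = 1 := whitened_gram hRT hPR rfl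
  have hMM : M⁻¹ * M = 1 := Matrix.nonsing_inv_mul M ((Matrix.isUnit_iff_isUnit_det M).1 hM.isUnit)
  refine ⟨frobSq (M * U) * frobSq Uᵀ, fun x m hx => ?_⟩
  set z := restr J x with hz
  set s : ℕ → Fin d → ℝ := fun i => Uᵀ *ᵥ z i with hs
  set ΔC : Matrix (Fin m) (Fin n ⊕ Fin d) ℝ :=
    Matrix.of fun i j => if h : j ∈ J then ((M * U) *ᵥ s i) ⟨j, h⟩ else 0 with hΔ
  have h0 : ∀ i, ∀ j ∉ J, ΔC i j = 0 := fun i j hj => by simp [hΔ, hj]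
  have hrow : ∀ i, (fun j : J => ΔC i j) = (M * U) *ᵥ s i := fun i => by
    funext j
    simp [hΔ]
  refine ⟨ΔC, ⟨(feasible_iff h0).2 fun i => ?_, h0, hX₀⟩, ?_⟩
  · have h1 : Wᵀ * (M * U) = Rᵀ := by
      rw [hUdef, ← Matrix.mul_assoc, ← Matrix.mul_assoc, hPR, Matrix.mul_assoc, hRT, Matrix.mul_one]
    have h2 : Rᵀ * Uᵀ = Wᵀ := by
      rw [← Matrix.transpose_mul, hUdef, Matrix.mul_assoc, hTR, Matrix.mul_one]
    have h3 : (Z X₀)ᵀ *ᵥ noisyRows X₀ a x i = Wᵀ *ᵥ z i := by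
      rw [transpose_Z_mulVec_noisyRows (hx i), sub_self, Matrix.transpose_zero, Matrix.zero_mulVec,
        zero_add]
    rw [hrow, Matrix.mulVec_mulVec, h1, hs]
    simp only
    rw [Matrix.mulVec_mulVec, h2]
    exact h3.symm
  · have h1 : ∀ i, weightedSq (Sig i) ((M * U) *ᵥ s i) ≤ ∑ j, (U.col j ⬝ᵥ z i) * (U.col j ⬝ᵥ z i) +
        frobSq (M * U) * frobSq Uᵀ * (absSum ((Sig i)⁻¹ - M⁻¹) * (z i ⬝ᵥ z i)) := by
      intro i
      set w := (M * U) *ᵥ s i with hw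
      have h2 : w ⬝ᵥ (M⁻¹ *ᵥ w) = s i ⬝ᵥ s i := by
        have h3 : M⁻¹ *ᵥ w = U *ᵥ s i := by
          rw [hw, Matrix.mulVec_mulVec, ← Matrix.mul_assoc, hMM, Matrix.one_mul]
        rw [h3, dotProduct_comm, hw, ← Matrix.mulVec_mulVec (s i) M U, mulVec_dotProduct_mulVec_mulVec, hU,
          Matrix.one_mulVec]
      have h3 := (abs_le.1 (abs_quadForm_le ((Sig i)⁻¹ - M⁻¹) w)).2
      rw [Matrix.sub_mulVec, dotProduct_sub, h2] at h3
      have h4 : s i ⬝ᵥ s i = ∑ j, (U.col j ⬝ᵥ z i) * (U.col j ⬝ᵥ z i) := rfl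
      have h5 : w ⬝ᵥ w ≤ frobSq (M * U) * (frobSq Uᵀ * (z i ⬝ᵥ z i)) :=
        (mulVec_dotProduct_self_le _ _).trans
          (mul_le_mul_of_nonneg_left (mulVec_dotProduct_self_le _ _) (frobSq_nonneg _))
      have h6 := mul_le_mul_of_nonneg_left h5 (absSum_nonneg ((Sig i)⁻¹ - M⁻¹))
      rw [← h4]
      unfold weightedSq
      linarith
    have h2 : 1 / (m : ℝ) * cost J Sig ΔC ≤
        mean m (fun i => ∑ j, (U.col j ⬝ᵥ z i) * (U.col j ⬝ᵥ z i) +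
        frobSq (M * U) * frobSq Uᵀ * (absSum ((Sig i)⁻¹ - M⁻¹) * (z i ⬝ᵥ z i))) := by
      refine mul_le_mul_of_nonneg_left ?_ (by positivity)
      rw [← Fin.sum_univ_eq_sum_range]
      refine Finset.sum_le_sum fun i _ => ?_
      rw [hrow]
      exact h1 i
    refine h2.trans ?_
    rw [mean_add, mean_const_mul, mean_sum (f := fun j i => (U.col j ⬝ᵥ z i) * (U.col j ⬝ᵥ z i)),
      ← add_assoc]
    refine add_le_add_left ?_ _
    set E := avg m (fun i => Matrix.vecMulVec (z i) (z i)) with hE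
    have h3 : ∀ j ∈ Finset.univ, mean m (fun i => (U.col j ⬝ᵥ z i) * (U.col j ⬝ᵥ z i)) ≤
        σ ^ 2 + absSum (E - σ ^ 2 • M) / k := by
      intro j _
      rw [← dotProduct_avg_mulVec, ← hE]
      have h4 := (abs_le.1 (abs_quadForm_le (E - σ ^ 2 • M) (U.col j))).2
      rw [Matrix.sub_mulVec, dotProduct_sub, Matrix.smul_mulVec, dotProduct_smul,
        col_dotProduct_mulVec_col U M, hU, Matrix.one_apply_eq, smul_eq_mul, mul_one] at h4
      have h5 := mul_le_mul_of_nonneg_left (col_dotProduct_self_le hk hMk hU j)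
        (absSum_nonneg (E - σ ^ 2 • M))
      rw [mul_one_div] at h5
      linarith
    refine (Finset.sum_le_sum h3).trans (le_of_eq ?_)
    simp only [Finset.sum_const, Finset.card_univ, Fintype.card_fin, nsmul_eq_mul]
    ring

/-- The rank condition is not closed, so it is dropped: minimize over a ball around `X₀` and
corrections no dearer than `ΔC₀`. This set is compact because positive definite weights bound the
corrections. By `hrank` the minimizer satisfies the rank condition, and by `hloc` no cheaper
competitor lies outside the ball. -/
theorem exists_solves_of_localized {m : ℕ} {Sig : ℕ → Matrix J J ℝ} (hSig : ∀ i, (Sig i).PosDef)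
    {C : Matrix (Fin m) (Fin n ⊕ Fin d) ℝ} {X₀ : Matrix (Fin n) (Fin d) ℝ}
    {ΔC₀ : Matrix (Fin m) (Fin n ⊕ Fin d) ℝ} (h₀ : Feasible J C X₀ ΔC₀) {η : ℝ}
    (hloc : ∀ X ΔC, Feasible J C X ΔC → cost J Sig ΔC ≤ cost J Sig ΔC₀ → frobSq (X - X₀) ≤ η)
    (hrank : ∀ X, frobSq (X - X₀) ≤ η → (ZJ J X).rank = d) : ∃ X, Solves J Sig C X := by
  have hcost : Continuous fun ΔC : Matrix (Fin m) (Fin n ⊕ Fin d) ℝ => cost J Sig ΔC := by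
    unfold cost weightedSq
    fun_prop
  have hnn : ∀ i (w : J → ℝ), 0 ≤ weightedSq (Sig i) w := fun i w => by
    simpa [weightedSq] using (hSig i).inv.posSemidef.dotProduct_mulVec_nonneg w
  set K : ℝ := ∑ i : Fin m, (absSum (Sig i) + 1) with hK
  have hK0 : 0 ≤ K := Finset.sum_nonneg fun i _ => by linarith [absSum_nonneg (Sig i)]
  set S : Set (Matrix (Fin n) (Fin d) ℝ × Matrix (Fin m) (Fin n ⊕ Fin d) ℝ) :=
    {p | frobSq (p.1 - X₀) ≤ η ∧ (C.toCols₁ - p.2.toCols₁) * p.1 = C.toCols₂ - p.2.toCols₂ ∧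
      (∀ i, ∀ j ∉ J, p.2 i j = 0) ∧ cost J Sig p.2 ≤ cost J Sig ΔC₀} with hS
  have hclosed : IsClosed S := by
    have c1 : IsClosed {p : Matrix (Fin n) (Fin d) ℝ × Matrix (Fin m) (Fin n ⊕ Fin d) ℝ |
        frobSq (p.1 - X₀) ≤ η} :=
      isClosed_le (continuous_frobSq.comp (continuous_fst.sub continuous_const)) continuous_const
    have c2 : IsClosed {p : Matrix (Fin n) (Fin d) ℝ × Matrix (Fin m) (Fin n ⊕ Fin d) ℝ |
        (C.toCols₁ - p.2.toCols₁) * p.1 = C.toCols₂ - p.2.toCols₂} := by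
      refine isClosed_eq ?_ ?_
      · unfold Matrix.toCols₁
        fun_prop
      · unfold Matrix.toCols₂
        fun_prop
    have c3 : IsClosed {p : Matrix (Fin n) (Fin d) ℝ × Matrix (Fin m) (Fin n ⊕ Fin d) ℝ |
        ∀ i, ∀ j ∉ J, p.2 i j = 0} := by
      simp only [Set.ofPred_forall]
      refine isClosed_iInter fun i => isClosed_iInter fun j => isClosed_iInter fun _ =>
        isClosed_eq ?_ continuous_const
      fun_prop
    have c4 : IsClosed {p : Matrix (Fin n) (Fin d) ℝ × Matrix (Fin m) (Fin n ⊕ Fin d) ℝ |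
        cost J Sig p.2 ≤ cost J Sig ΔC₀} :=
      isClosed_le (hcost.comp continuous_snd) continuous_const
    exact c1.inter (c2.inter (c3.inter c4))
  have hsub : S ⊆ {X | frobSq (X - X₀) ≤ η} ×ˢ {ΔC | frobSq (ΔC - 0) ≤ K * cost J Sig ΔC₀} := by
    rintro ⟨X, ΔC⟩ ⟨h1, -, h3, h4⟩
    refine ⟨h1, ?_⟩
    change frobSq (ΔC - 0) ≤ _
    rw [sub_zero]
    refine le_trans ?_ (mul_le_mul_of_nonneg_left h4 hK0)
    rw [cost, Finset.mul_sum, frobSq]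
    refine Finset.sum_le_sum fun i _ => ?_
    have h5 : ∑ j, ΔC i j ^ 2 = (fun j : J => ΔC i j) ⬝ᵥ (fun j : J => ΔC i j) := by
      rw [dotProduct_self_eq_sum_sq]
      refine Eq.trans ?_ (Finset.sum_coe_sort J fun j => ΔC i j ^ 2).symm
      refine (Finset.sum_subset (Finset.subset_univ J) fun j _ hj => ?_).symm
      exact (pow_eq_zero_iff two_ne_zero).2 (h3 i j hj)
    rw [h5]
    refine (dotProduct_self_le_mul_weightedSq (hSig i)
      (by linarith [absSum_nonneg (Sig i)] : 0 < absSum (Sig i) + 1) (by linarith) _).trans ?_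
    refine mul_le_mul_of_nonneg_right ?_ (hnn _ _)
    exact Finset.single_le_sum (f := fun i : Fin m => absSum (Sig i) + 1)
      (fun i _ => by linarith [absSum_nonneg (Sig i)]) (Finset.mem_univ i)
  have hcompact : IsCompact S :=
    ((isCompact_frobSq_sub_le X₀ η).prod (isCompact_frobSq_sub_le 0 _)).of_isClosed_subset hclosed
      hsub
  obtain ⟨⟨X, ΔC⟩, ⟨h1, h2, h3, h4⟩, hmin⟩ := hcompact.exists_isMinOn
    ⟨(X₀, ΔC₀), hloc _ _ h₀ le_rfl, h₀.1, h₀.2.1, le_rfl⟩ (hcost.comp continuous_snd).continuousOn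
  refine ⟨X, ΔC, ⟨h2, h3, hrank X h1⟩, fun X' ΔC' hF => ?_⟩
  rcases le_total (cost J Sig ΔC') (cost J Sig ΔC₀) with hle | hle
  · exact hmin (a := (X', ΔC')) ⟨hloc _ _ hF hle, hF.1, hF.2.1, hle⟩
  · exact h4.trans hle

end Cost

/-! ### Limits of matrix expressions along a filter. -/

section Limits

variable {α ι κ : Type*} {L : Filter α}

theorem tendsto_matrix_iff {A : α → Matrix ι κ ℝ} {B : Matrix ι κ ℝ} :
    Tendsto A L (𝓝 B) ↔ ∀ i j, Tendsto (fun p => A p i j) L (𝓝 (B i j)) := by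
  refine (tendsto_pi_nhds (f := A)).trans (forall_congr' fun i => ?_)
  exact tendsto_pi_nhds

variable [Fintype ι]

theorem tendsto_matrix_mul {γ : Type*} {A : α → Matrix γ ι ℝ} {B : α → Matrix ι κ ℝ}
    {A₀ : Matrix γ ι ℝ} {B₀ : Matrix ι κ ℝ} (hA : Tendsto A L (𝓝 A₀)) (hB : Tendsto B L (𝓝 B₀)) :
    Tendsto (fun p => A p * B p) L (𝓝 (A₀ * B₀)) :=
  ((continuous_fst.matrix_mul continuous_snd).tendsto (A₀, B₀)).comp (hA.prodMk_nhds hB)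

variable [Fintype κ]

theorem tendsto_absSum_sub {A : α → Matrix ι κ ℝ} {B : Matrix ι κ ℝ} (h : Tendsto A L (𝓝 B)) :
    Tendsto (fun p => absSum (A p - B)) L (𝓝 0) := by
  have h1 : Tendsto (fun p => A p - B) L (𝓝 0) := by
    simpa using h.sub (tendsto_const_nhds (x := B))
  simpa [Function.comp_def] using (continuous_absSum.tendsto _).comp h1

theorem tendsto_matrix_inv [DecidableEq ι] {A : α → Matrix ι ι ℝ} {B : Matrix ι ι ℝ}
    (h : Tendsto A L (𝓝 B)) (hB : B.det ≠ 0) : Tendsto (fun p => (A p)⁻¹) L (𝓝 B⁻¹) := by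
  simp_rw [Matrix.inv_def, Ring.inverse_eq_inv']
  exact (((continuous_id.matrix_det.tendsto B).comp h).inv₀ hB).smul
    ((continuous_id.matrix_adjugate.tendsto B).comp h)

theorem tendsto_signalErr {m : α → ℕ} {k : ℝ} {a : ℕ → κ → ℝ} {x : α → ℕ → ι → ℝ} {ε : ℕ → ℝ}
    {V : Matrix κ κ ℝ}
    (hA : Tendsto (fun p => avg (m p) fun i => Matrix.vecMulVec (a i) (a i)) L (𝓝 V))
    (hB : Tendsto (fun p => avg (m p) fun i => Matrix.vecMulVec (a i) (x p i)) L (𝓝 0))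
    (hεa : Tendsto (fun p => mean (m p) fun i => ε i * (a i ⬝ᵥ a i)) L (𝓝 0)) :
    Tendsto (fun p => signalErr (m p) k a (x p) ε V) L (𝓝 0) := by
  have hB' := tendsto_absSum_sub hB
  simp only [sub_zero] at hB'
  simpa [signalErr] using ((tendsto_absSum_sub hA).add hB').add (hεa.const_mul (2 / k))

theorem tendsto_noiseErr {m : α → ℕ} {k : ℝ} {a : ℕ → κ → ℝ} {x : α → ℕ → ι → ℝ} {ε : ℕ → ℝ}
    {N : Matrix ι ι ℝ}
    (hB : Tendsto (fun p => avg (m p) fun i => Matrix.vecMulVec (a i) (x p i)) L (𝓝 0))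
    (hE : Tendsto (fun p => avg (m p) fun i => Matrix.vecMulVec (x p i) (x p i)) L (𝓝 N))
    (hεx : Tendsto (fun p => mean (m p) fun i => ε i * (x p i ⬝ᵥ x p i)) L (𝓝 0)) :
    Tendsto (fun p => noiseErr (m p) k a (x p) ε N) L (𝓝 0) := by
  have hB' := tendsto_absSum_sub hB
  simp only [sub_zero] at hB'
  simpa [noiseErr] using
    ((hB'.add (tendsto_absSum_sub hE)).add (hεx.const_mul (2 / k))).div_const k

end Limits

/-! ### Deterministic consistency and limits of the two statistics. -/

section Consistency

variable {n d : ℕ} {J : Finset (Fin n ⊕ Fin d)} {α : Type*} {L : Filter α}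

theorem continuous_ZJ : Continuous (ZJ J : Matrix (Fin n) (Fin d) ℝ → _) := by
  refine continuous_matrix fun p q => ?_
  obtain ⟨p | p, hp⟩ := p
  · exact continuous_id.matrix_elem p q
  · exact continuous_const

theorem continuous_Z : Continuous (Z : Matrix (Fin n) (Fin d) ℝ → _) := by
  refine continuous_matrix fun p q => ?_
  obtain p | p := p
  · exact continuous_id.matrix_elem p q
  · exact continuous_const

theorem eventually_exists_solves_and_mem {Sig : ℕ → Matrix J J ℝ} (hSig : ∀ i, (Sig i).PosDef)
    {M : Matrix J J ℝ} (hM : M.PosDef) (hSigM : Tendsto Sig atTop (𝓝 M))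
    {V : Matrix (Fin n) (Fin n) ℝ} (hV : V.PosDef) {X₀ : Matrix (Fin n) (Fin d) ℝ}
    (hX₀ : (ZJ J X₀).rank = d) (σ : ℝ) {a : ℕ → Fin n → ℝ} {m : α → ℕ}
    {x : α → ℕ → Fin n ⊕ Fin d → ℝ} (hx : ∀ᶠ p in L, ∀ i, ∀ j ∉ J, x p i j = 0)
    (hA : Tendsto (fun p => avg (m p) fun i => Matrix.vecMulVec (a i) (a i)) L (𝓝 V))
    (hB : Tendsto (fun p => avg (m p) fun i => Matrix.vecMulVec (a i) (restr J (x p) i)) L (𝓝 0))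
    (hE : Tendsto (fun p => avg (m p) fun i =>
      Matrix.vecMulVec (restr J (x p) i) (restr J (x p) i)) L (𝓝 (σ ^ 2 • M)))
    (hεa : ∀ ε : ℕ → ℝ, (∀ i, 0 ≤ ε i) → Tendsto ε atTop (𝓝 0) →
      Tendsto (fun p => mean (m p) fun i => ε i * (a i ⬝ᵥ a i)) L (𝓝 0))
    (hεx : ∀ ε : ℕ → ℝ, (∀ i, 0 ≤ ε i) → Tendsto ε atTop (𝓝 0) →
      Tendsto (fun p => mean (m p) fun i => ε i * (restr J (x p) i ⬝ᵥ restr J (x p) i)) L (𝓝 0))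
    {U : Set (Matrix (Fin n) (Fin d) ℝ)} (hU : U ∈ 𝓝 X₀) :
    ∀ᶠ p in L, (∃ X, Solves J Sig (rowMatrix (m p) (noisyRows X₀ a (x p))) X) ∧
      ∀ X, Solves J Sig (rowMatrix (m p) (noisyRows X₀ a (x p))) X → X ∈ U := by
  obtain ⟨k, hk, hMk⟩ := exists_quadForm_lower_bound hM
  obtain ⟨l, hl, hVl⟩ := exists_quadForm_lower_bound hV
  have hrank : ∀ᶠ X in 𝓝 X₀, (ZJ J X).rank = d := by
    have hc : Continuous fun X : Matrix (Fin n) (Fin d) ℝ => ((ZJ J X)ᵀ * M * ZJ J X).det :=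
      ((continuous_ZJ.matrix_transpose.matrix_mul continuous_const).matrix_mul
        continuous_ZJ).matrix_det
    have h0 : ((ZJ J X₀)ᵀ * M * ZJ J X₀).det ≠ 0 :=
      (posDef_transpose_mul_mul_of_rank hM (by simpa using hX₀)).det_pos.ne'
    filter_upwards [hc.continuousAt.eventually_ne h0] with X hX
    simpa using rank_eq_card_of_det_ne_zero hX
  obtain ⟨η, hη, hηU⟩ := exists_frobSq_sub_le_imp_mem (inter_mem hU hrank)
  obtain ⟨K, hK⟩ := exists_feasible_cost_le hM hk hMk σ hX₀ Sig a
  set w := frobSq (ZJ J X₀) with hw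
  have hw0 : 0 ≤ w := frobSq_nonneg _
  set B := 2 * absSum M with hBdef
  have hB0 : 0 ≤ B := by linarith [absSum_nonneg M]
  -- With `N = frobSq (X - X₀)`, the bound `N ≤ y₀ B (w + N)` has to give `N ≤ η`: the first
  -- condition absorbs `y₀ B N` into `N / 2`, the second makes `2 y₀ B w ≤ η`.
  obtain ⟨y₀, hy₀, hy₁, hy₂⟩ : ∃ y : ℝ, 0 < y ∧ y * B ≤ 1 / 2 ∧ y * (2 * B * w) ≤ η := by
    refine ⟨min (1 / (2 * (B + 1))) (η / (2 * B * w + 1)), by positivity, ?_, ?_⟩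
    · refine (mul_le_mul_of_nonneg_right (min_le_left _ _) hB0).trans ?_
      rw [div_mul_eq_mul_div, div_le_div_iff₀ (by positivity) (by norm_num)]
      linarith
    · refine (mul_le_mul_of_nonneg_right (min_le_right _ _) (by positivity)).trans ?_
      rw [div_mul_eq_mul_div, div_le_iff₀ (by positivity)]
      nlinarith
  have hε := tendsto_absSum_sub hSigM
  have hε' := tendsto_absSum_sub (tendsto_matrix_inv hSigM hM.det_pos.ne')
  have hR₁ := tendsto_signalErr (k := k) hA hB (hεa _ (fun _ => absSum_nonneg _) hε)
  have hR₂ := tendsto_noiseErr (k := k) (a := a) hB hE (hεx _ (fun _ => absSum_nonneg _) hε)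
  have hR₃ := ((tendsto_absSum_sub hE).const_mul (d / k)).add
    ((hεx _ (fun _ => absSum_nonneg _) hε').const_mul K)
  have hR := (hR₂.const_mul (d : ℝ)).add hR₃
  simp only [mul_zero, add_zero] at hR
  filter_upwards [hx, hR₁.eventually_le_const (half_pos hl),
    hR.eventually_le_const (mul_pos (half_pos hl) hy₀)] with p hxp h₁ h₂
  obtain ⟨ΔC₀, hF₀, hC₀⟩ := hK (x p) (m p) hxp
  have hloc : ∀ X ΔC, Feasible J (rowMatrix (m p) (noisyRows X₀ a (x p))) X ΔC →
      cost J Sig ΔC ≤ cost J Sig ΔC₀ → frobSq (X - X₀) ≤ η := by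
    intro X ΔC hF hcost
    obtain ⟨y, hy, hXy, hcy⟩ := mean_cost_ge (σ := σ) hSig hM hk hMk hVl hxp hF
    have h₃ := mul_le_mul_of_nonneg_left hcost (by positivity : (0 : ℝ) ≤ 1 / (m p : ℝ))
    -- Comparing the lower bound at `X` with the upper bound at `X₀`, the terms `d σ ^ 2` cancel. By
    -- `h₁` at least `l / 2 * y` remains on the left, and by `h₂` the errors total at most `l / 2 *
    -- y₀`.
    have h₄ : l / 2 * y ≤ l / 2 * y₀ := by nlinarith
    have h₅ : y ≤ y₀ := le_of_mul_le_mul_left h₄ (half_pos hl)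
    have hN := frobSq_nonneg (X - X₀)
    have h₆ : y * (B * (w + frobSq (X - X₀))) ≤ y₀ * (B * (w + frobSq (X - X₀))) :=
      mul_le_mul_of_nonneg_right h₅ (by positivity)
    nlinarith [mul_le_mul_of_nonneg_right hy₁ hN]
  refine ⟨exists_solves_of_localized hSig hF₀ hloc fun X hX => (hηU X hX).2, ?_⟩
  rintro X ⟨ΔC, hF, hmin⟩
  exact (hηU X (hloc X ΔC hF (hmin _ _ hF₀))).1

/-- The extension by zero of a matrix indexed by `J`. -/
def extendZero (M : Matrix J J ℝ) : Matrix (Fin n ⊕ Fin d) (Fin n ⊕ Fin d) ℝ :=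
  Matrix.of fun p q => if h : p ∈ J ∧ q ∈ J then M ⟨p, h.1⟩ ⟨q, h.2⟩ else 0

theorem transpose_Z_mul_extendZero_mul_Z (M : Matrix J J ℝ) (X : Matrix (Fin n) (Fin d) ℝ) :
    (Z X)ᵀ * extendZero M * Z X = (ZJ J X)ᵀ * M * ZJ J X := by
  ext s t
  simp only [Matrix.mul_apply, Matrix.transpose_apply, Finset.sum_mul]
  have h1 : ∀ q ∉ J, ∀ p, Z X p s * extendZero M p q * Z X q t = 0 := fun q hq p => by
    simp [extendZero, hq]
  have h2 : ∀ q, ∀ p ∉ J, Z X p s * extendZero M p q * Z X q t = 0 := fun q p hp => by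
    simp [extendZero, hp]
  rw [← Finset.sum_subset (Finset.subset_univ J) fun q _ hq =>
    Finset.sum_eq_zero fun p _ => h1 q hq p]
  rw [← Finset.sum_coe_sort J]
  refine Finset.sum_congr rfl fun q _ => ?_
  rw [← Finset.sum_subset (Finset.subset_univ J) fun p _ hp => h2 q p hp]
  rw [← Finset.sum_coe_sort J]
  refine Finset.sum_congr rfl fun p _ => ?_
  simp [extendZero, ZJ]

/-- The limit of the averaged `c cᵀ` without the noise part. -/
def signalGram (X₀ : Matrix (Fin n) (Fin d) ℝ) (V : Matrix (Fin n) (Fin n) ℝ) :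
    Matrix (Fin n ⊕ Fin d) (Fin n ⊕ Fin d) ℝ :=
  (Matrix.fromCols 1 X₀)ᵀ * V * Matrix.fromCols 1 X₀

/-- The true rows satisfy the model exactly: `[1, X₀] Z(X₀) = X₀ - X₀ = 0`. -/
theorem signalGram_mul_Z (X₀ : Matrix (Fin n) (Fin d) ℝ) (V : Matrix (Fin n) (Fin n) ℝ) :
    signalGram X₀ V * Z X₀ = 0 := by
  rw [signalGram, Matrix.mul_assoc, Z, Matrix.fromCols_mul_fromRows]
  simp

/-- With the signal annihilated, the numerator tends to `σ ^ 2 • P` and the denominator to `P`. The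
trace of `σ ^ 2 • P * P⁻¹` is `d σ ^ 2`. -/
theorem tendsto_sigmaSq {M : Matrix J J ℝ} (hM : M.PosDef) (hd : 1 ≤ d)
    {V : Matrix (Fin n) (Fin n) ℝ} {X₀ : Matrix (Fin n) (Fin d) ℝ}
    (hX₀ : (ZJ J X₀).rank = d) (σ : ℝ) {m : α → ℕ} {c : α → ℕ → Fin n ⊕ Fin d → ℝ}
    {S : ℕ → Matrix (Fin n ⊕ Fin d) (Fin n ⊕ Fin d) ℝ}
    (hc : Tendsto (fun p => avg (m p) fun i => Matrix.vecMulVec (c p i) (c p i)) L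
      (𝓝 (signalGram X₀ V + σ ^ 2 • extendZero M)))
    (hS : Tendsto (fun p => avg (m p) S) L (𝓝 (extendZero M)))
    {g : α → Matrix (Fin n) (Fin d) ℝ} (hg : Tendsto g L (𝓝 X₀)) :
    Tendsto (fun p => sigmaSq (m p) (c p) S (g p)) L (𝓝 (σ ^ 2)) := by
  have hZ : Tendsto (fun p => Z (g p)) L (𝓝 (Z X₀)) := (continuous_Z.tendsto _).comp hg
  have hZt : Tendsto (fun p => (Z (g p))ᵀ) L (𝓝 (Z X₀)ᵀ) :=
    (continuous_id.matrix_transpose.tendsto _).comp hZ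
  set P := (ZJ J X₀)ᵀ * M * ZJ J X₀ with hP
  have hPd : P.det ≠ 0 :=
    (posDef_transpose_mul_mul_of_rank hM (W := ZJ J X₀) (by simpa using hX₀)).det_pos.ne'
  have h1 := tendsto_matrix_mul (tendsto_matrix_mul hZt hS) hZ
  rw [transpose_Z_mul_extendZero_mul_Z, ← hP] at h1
  have h2 := tendsto_matrix_mul (tendsto_matrix_mul hZt hc) hZ
  have h3 : (Z X₀)ᵀ * (signalGram X₀ V + σ ^ 2 • extendZero M) * Z X₀ = σ ^ 2 • P := by
    rw [Matrix.mul_assoc, Matrix.add_mul, signalGram_mul_Z, zero_add, Matrix.smul_mul,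
      Matrix.mul_smul, ← Matrix.mul_assoc, transpose_Z_mul_extendZero_mul_Z]
  rw [h3] at h2
  have h4 := ((continuous_id.matrix_trace.tendsto _).comp
    (h2.mul (tendsto_matrix_inv h1 hPd))).const_mul (1 / (d : ℝ))
  have h5 : 1 / (d : ℝ) * (id (σ ^ 2 • P * P⁻¹)).trace = σ ^ 2 := by
    have hd' : (d : ℝ) ≠ 0 := by positivity
    rw [id, Matrix.smul_mul, Matrix.mul_nonsing_inv _ (isUnit_iff_ne_zero.2 hPd),
      Matrix.trace_smul, Matrix.trace_one, Fintype.card_fin, smul_eq_mul]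
    field_simp
  rw [h5] at h4
  exact h4

theorem tendsto_vA {M : Matrix J J ℝ} {V : Matrix (Fin n) (Fin n) ℝ}
    {X₀ : Matrix (Fin n) (Fin d) ℝ} {σ : ℝ} {m : α → ℕ} {c : α → ℕ → Fin n ⊕ Fin d → ℝ}
    {S : ℕ → Matrix (Fin n ⊕ Fin d) (Fin n ⊕ Fin d) ℝ}
    (hc : Tendsto (fun p => avg (m p) fun i => Matrix.vecMulVec (c p i) (c p i)) L
      (𝓝 (signalGram X₀ V + σ ^ 2 • extendZero M)))
    (hS : Tendsto (fun p => avg (m p) S) L (𝓝 (extendZero M)))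
    {g : α → Matrix (Fin n) (Fin d) ℝ}
    (hσ : Tendsto (fun p => sigmaSq (m p) (c p) S (g p)) L (𝓝 (σ ^ 2))) :
    Tendsto (fun p => vA (m p) (c p) S (g p)) L (𝓝 V) := by
  have hb : Continuous fun A : Matrix (Fin n ⊕ Fin d) (Fin n ⊕ Fin d) ℝ => A.toBlocks₁₁ := by
    unfold Matrix.toBlocks₁₁
    fun_prop
  have h1 := ((hb.tendsto _).comp hc).sub (hσ.smul ((hb.tendsto _).comp hS))
  have h2 : (signalGram X₀ V).toBlocks₁₁ = V := by
    rw [signalGram, Matrix.transpose_fromCols, Matrix.fromRows_mul, Matrix.fromRows_mul_fromCols]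
    simp
  have h3 : (signalGram X₀ V + σ ^ 2 • extendZero M).toBlocks₁₁ -
      σ ^ 2 • (extendZero M).toBlocks₁₁ = V := by
    conv_rhs => rw [← h2]
    ext i j
    simp [Matrix.toBlocks₁₁]
  rw [h3] at h1
  refine h1.congr fun p => ?_
  simp only [Function.comp_apply, vA]
  congr 1
  ext i j
  simp [Matrix.toBlocks₁₁, avg_apply, Matrix.vecMulVec_apply]

theorem tendsto_avg_noisyRows {M : Matrix J J ℝ} {V : Matrix (Fin n) (Fin n) ℝ}
    (X₀ : Matrix (Fin n) (Fin d) ℝ) {σ : ℝ} {a : ℕ → Fin n → ℝ} {m : α → ℕ}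
    {x : α → ℕ → Fin n ⊕ Fin d → ℝ} (hx : ∀ᶠ p in L, ∀ i, ∀ j ∉ J, x p i j = 0)
    (hA : Tendsto (fun p => avg (m p) fun i => Matrix.vecMulVec (a i) (a i)) L (𝓝 V))
    (hB : Tendsto (fun p => avg (m p) fun i => Matrix.vecMulVec (a i) (restr J (x p) i)) L (𝓝 0))
    (hE : Tendsto (fun p => avg (m p) fun i =>
      Matrix.vecMulVec (restr J (x p) i) (restr J (x p) i)) L (𝓝 (σ ^ 2 • M))) :
    Tendsto (fun p => avg (m p) fun i =>
      Matrix.vecMulVec (noisyRows X₀ a (x p) i) (noisyRows X₀ a (x p) i)) L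
      (𝓝 (signalGram X₀ V + σ ^ 2 • extendZero M)) := by
  rw [tendsto_matrix_iff] at hA hB hE ⊢
  simp only [avg_apply, Matrix.vecMulVec_apply] at hA hB hE ⊢
  set F : Matrix (Fin n) (Fin n ⊕ Fin d) ℝ := Matrix.fromCols 1 X₀ with hF
  have hmean : ∀ m, mean m (fun _ => 0) = 0 := fun m => by simp [mean]
  have hB' : ∀ k q, Tendsto (fun p => mean (m p) fun i => a i k * x p i q) L (𝓝 0) := by
    intro k q
    by_cases hq : q ∈ J
    · exact hB k ⟨q, hq⟩
    · refine tendsto_const_nhds.congr' ?_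
      filter_upwards [hx] with p hp
      simp [hp _ q hq, hmean]
  have hE' : ∀ q r, Tendsto (fun p => mean (m p) fun i => x p i q * x p i r) L
      (𝓝 (σ ^ 2 * extendZero M q r)) := by
    intro q r
    by_cases hq : q ∈ J ∧ r ∈ J
    · simpa [extendZero, hq, restr] using hE ⟨q, hq.1⟩ ⟨r, hq.2⟩
    · have h0 : extendZero M q r = 0 := by simp [extendZero, hq]
      rw [h0, mul_zero]
      refine tendsto_const_nhds.congr' ?_
      filter_upwards [hx] with p hp
      rw [not_and_or] at hq
      rcases hq with hq | hq <;> simp [hp _ _ hq, hmean]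
  have hrow : ∀ p i q, noisyRows X₀ a (x p) i q = ∑ k, F k q * a i k + x p i q := by
    rintro p i (q | q)
    · simp [noisyRows, hF, Matrix.one_apply]
    · simp [noisyRows, hF, Matrix.mulVec, dotProduct]
  intro q r
  have h1 : ∀ p, mean (m p) (fun i => noisyRows X₀ a (x p) i q * noisyRows X₀ a (x p) i r) =
      ∑ k, ∑ l, F k q * F l r * mean (m p) (fun i => a i k * a i l) +
      ∑ k, F k q * mean (m p) (fun i => a i k * x p i r) +
      ∑ k, F k r * mean (m p) (fun i => a i k * x p i q) +
      mean (m p) (fun i => x p i q * x p i r) := by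
    intro p
    simp_rw [← mean_const_mul, ← mean_sum, ← mean_add]
    congr 1
    funext i
    rw [hrow, hrow, add_mul, mul_add, mul_add, Finset.sum_mul_sum, Finset.sum_mul, Finset.mul_sum,
      ← add_assoc]
    congr 1
    congr 1
    · congr 1
      · exact Finset.sum_congr rfl fun k _ => Finset.sum_congr rfl fun l _ => by ring
      · exact Finset.sum_congr rfl fun k _ => by ring
    · exact Finset.sum_congr rfl fun k _ => by ring
  simp_rw [h1]
  have h2 := (((tendsto_finsetSum Finset.univ fun k _ => tendsto_finsetSum Finset.univ fun l _ =>
    (hA k l).const_mul (F k q * F l r)).add (tendsto_finsetSum Finset.univ fun k _ =>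
    (hB' k r).const_mul (F k q))).add (tendsto_finsetSum Finset.univ fun k _ =>
    (hB' k q).const_mul (F k r))).add (hE' q r)
  convert h2 using 2
  have h3 : signalGram X₀ V q r = ∑ k, ∑ l, F k q * F l r * V k l := by
    rw [signalGram, Matrix.mul_apply, ← hF]
    simp_rw [Matrix.mul_apply, Finset.sum_mul, Matrix.transpose_apply]
    rw [Finset.sum_comm]
    exact Finset.sum_congr rfl fun k _ => Finset.sum_congr rfl fun l _ => by ring
  simp [h3]

end Consistency

/-! ### Convergence in probability as convergence along a filter. -/

section ProbFilter

variable {Ω : Type*} [MeasurableSpace Ω]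

/-- The filter of the sets of pairs `(m, ω)` whose sections have outer probability tending to one.
Convergence in probability is convergence along this filter. -/
def probFilter (P : Measure Ω) : Filter (ℕ × Ω) where
  sets := {A | Tendsto (fun m => P {ω | (m, ω) ∉ A}) atTop (𝓝 0)}
  univ_sets := by simp
  sets_of_superset {A B} hA hAB :=
    tendsto_of_tendsto_of_tendsto_of_le_of_le tendsto_const_nhds hA (fun _ => zero_le)
      fun _ => measure_mono fun _ hω h => hω (hAB h)
  inter_sets {A B} hA hB := by
    have h : Tendsto (fun m => P {ω | (m, ω) ∉ A} + P {ω | (m, ω) ∉ B}) atTop (𝓝 0) := by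
      have hA' : Tendsto (fun m => P {ω | (m, ω) ∉ A}) atTop (𝓝 0) := hA
      have hB' : Tendsto (fun m => P {ω | (m, ω) ∉ B}) atTop (𝓝 0) := hB
      simpa using hA'.add hB'
    refine tendsto_of_tendsto_of_tendsto_of_le_of_le tendsto_const_nhds h (fun _ => zero_le)
      fun m => (measure_mono fun ω hω => ?_).trans (measure_union_le _ _)
    by_contra h'
    simp only [Set.mem_union, Set.mem_ofPred_eq, not_or, not_not] at h'
    exact hω h'

variable {P : Measure Ω}

theorem eventually_probFilter {Q : ℕ × Ω → Prop} :
    (∀ᶠ p in probFilter P, Q p) ↔ Tendsto (fun m => P {ω | ¬ Q (m, ω)}) atTop (𝓝 0) :=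
  Iff.rfl

theorem tendsto_fst_probFilter : Tendsto Prod.fst (probFilter P) atTop := by
  rw [tendsto_atTop]
  intro N
  rw [eventually_probFilter]
  refine tendsto_const_nhds.congr' ?_
  filter_upwards [eventually_ge_atTop N] with m hm
  simp [hm]

theorem eventually_probFilter_of_ae {Q : Ω → Prop} (h : ∀ᵐ ω ∂P, Q ω) :
    ∀ᶠ p in probFilter P, Q p.2 := by
  rw [eventually_probFilter]
  refine tendsto_const_nhds.congr fun m => ?_
  exact (ae_iff.1 h).symm

/-- The gauge `g` covers Markov's inequality (`g δ = δ`) and Chebyshev's (`g δ = δ ^ 2`) at once. -/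
theorem tendsto_probFilter_zero {f : ℕ → Ω → ℝ} {b : ℕ → ℝ} (hb : Tendsto b atTop (𝓝 0))
    {g : ℝ → ℝ} (h : ∀ δ > 0, ∀ m, P {ω | δ ≤ |f m ω|} ≤ ENNReal.ofReal (b m / g δ)) :
    Tendsto (fun p : ℕ × Ω => f p.1 p.2) (probFilter P) (𝓝 0) := by
  rw [Metric.tendsto_nhds]
  intro δ hδ
  rw [eventually_probFilter]
  have h1 : Tendsto (fun m => ENNReal.ofReal (b m / g δ)) atTop (𝓝 0) := by
    simpa using ENNReal.tendsto_ofReal (hb.div_const (g δ))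
  refine tendsto_of_tendsto_of_tendsto_of_le_of_le tendsto_const_nhds h1 (fun _ => zero_le)
    fun m => ?_
  simpa using h δ hδ m

theorem tendsto_mean_of_nonneg [IsProbabilityMeasure P] {X : ℕ → Ω → ℝ} (h0 : ∀ i ω, 0 ≤ X i ω)
    (hX : ∀ i, Integrable (X i) P)
    (hlim : Tendsto (fun m => mean m fun i => ∫ ω, X i ω ∂P) atTop (𝓝 0)) :
    Tendsto (fun p : ℕ × Ω => mean p.1 fun i => X i p.2) (probFilter P) (𝓝 0) := by
  refine tendsto_probFilter_zero (f := fun m ω => mean m fun i => X i ω) hlim (g := id)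
    fun δ hδ m => ?_
  have hnn : ∀ ω, 0 ≤ mean m fun i => X i ω := fun ω => mean_nonneg fun i => h0 i ω
  have hint : Integrable (fun ω => mean m fun i => X i ω) P :=
    (integrable_finsetSum _ fun i _ => hX i).const_mul _
  have h1 := mul_meas_ge_le_integral_of_nonneg (ae_of_all P hnn) hint δ
  have h2 : ∫ ω, mean m (fun i => X i ω) ∂P = mean m fun i => ∫ ω, X i ω ∂P := by
    simp only [mean]
    rw [integral_const_mul, integral_finsetSum _ fun i _ => hX i]
  rw [h2] at h1
  simp_rw [abs_of_nonneg (hnn _)]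
  rw [← ofReal_measureReal]
  refine ENNReal.ofReal_le_ofReal ?_
  rw [id, le_div_iff₀ hδ, mul_comm]
  exact h1

/-- Chebyshev's inequality with additivity of variances. The bounds `v i` need not be uniform, which
admits summands scaled by unbounded inputs. -/
theorem tendsto_mean_sub_mean_integral [IsProbabilityMeasure P] {X : ℕ → Ω → ℝ}
    (hX : ∀ i, MemLp (X i) 2 P) (hind : Pairwise fun i j => IndepFun (X i) (X j) P)
    {v : ℕ → ℝ} (hv : ∀ i, variance (X i) P ≤ v i)
    (hlim : Tendsto (fun m : ℕ => (1 / (m : ℝ)) * mean m v) atTop (𝓝 0)) :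
    Tendsto (fun p : ℕ × Ω => mean p.1 (fun i => X i p.2) - mean p.1 fun i => ∫ ω, X i ω ∂P)
      (probFilter P) (𝓝 0) := by
  refine tendsto_probFilter_zero
    (f := fun m ω => mean m (fun i => X i ω) - mean m fun i => ∫ ω, X i ω ∂P) hlim
    (g := fun δ => δ ^ 2) fun δ hδ m => ?_
  have hmem : MemLp (fun ω => mean m fun i => X i ω) 2 P :=
    (memLp_finsetSum (Finset.range m) fun i _ => hX i).const_mul _
  have h1 := meas_ge_le_variance_div_sq hmem hδ
  have h2 : ∫ ω, mean m (fun i => X i ω) ∂P = mean m fun i => ∫ ω, X i ω ∂P := by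
    simp only [mean]
    rw [integral_const_mul,
      integral_finsetSum _ fun i _ => (hX i).integrable (by norm_num)]
  rw [h2] at h1
  refine h1.trans (ENNReal.ofReal_le_ofReal ?_)
  refine div_le_div_of_nonneg_right ?_ (by positivity)
  have h3 : variance (fun ω => mean m fun i => X i ω) P =
      (1 / (m : ℝ)) ^ 2 * ∑ i ∈ Finset.range m, variance (X i) P := by
    simp only [mean]
    rw [variance_const_mul, ← IndepFun.variance_sum (fun i _ => hX i) fun i _ j _ hij => hind hij]
    congr 2
    funext ω
    simp
  rw [h3, mean, ← mul_assoc, ← sq]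
  exact mul_le_mul_of_nonneg_left (Finset.sum_le_sum fun i _ => hv i) (by positivity)

end ProbFilter

/-! ### Cesàro averages with vanishing weights. -/

section Cesaro

theorem tendsto_mean {u : ℕ → ℝ} {l : ℝ} (h : Tendsto u atTop (𝓝 l)) :
    Tendsto (fun m => mean m u) atTop (𝓝 l) := by
  simpa [mean] using h.cesaro

/-- Terms that are `o(b i + 1)` have partial sums `o(∑ (b i + 1))`, and these sums are `O(m)`. The
added one makes the comparison series diverge even if `b` is summable. -/
theorem tendsto_mean_mul_zero {ε b : ℕ → ℝ} {l : ℝ} (hε : Tendsto ε atTop (𝓝 0))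
    (hb0 : ∀ i, 0 ≤ b i) (hb : Tendsto (fun m => mean m b) atTop (𝓝 l)) :
    Tendsto (fun m => mean m fun i => ε i * b i) atTop (𝓝 0) := by
  have h1 : (fun i => ε i * b i) =o[atTop] fun i => b i + 1 := by
    have h2 : ε =o[atTop] fun _ => (1 : ℝ) := (Asymptotics.isLittleO_one_iff ℝ).2 hε
    have h3 : b =O[atTop] fun i => b i + 1 := by
      refine Asymptotics.IsBigO.of_bound 1 (Eventually.of_forall fun i => ?_)
      rw [Real.norm_of_nonneg (hb0 i), Real.norm_of_nonneg (by linarith [hb0 i])]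
      linarith
    simpa using h2.mul_isBigO h3
  have h4 : Tendsto (fun m => ∑ i ∈ Finset.range m, (b i + 1)) atTop atTop := by
    refine tendsto_atTop_mono (fun m => ?_) tendsto_natCast_atTop_atTop
    rw [Finset.sum_add_distrib]
    simpa using Finset.sum_nonneg fun i (_ : i ∈ Finset.range m) => hb0 i
  have h5 := h1.sum_range (fun i => by simpa using add_nonneg (hb0 i) zero_le_one) h4
  have h6 := (Asymptotics.isBigO_refl (fun m : ℕ => 1 / (m : ℝ)) atTop).mul_isLittleO h5
  have h7 : Tendsto (fun m => mean m fun i => b i + 1) atTop (𝓝 (l + 1)) := by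
    simp_rw [mean_add]
    exact hb.add (tendsto_mean tendsto_const_nhds)
  exact (Asymptotics.isLittleO_one_iff ℝ).1 (h6.trans_isBigO (h7.isBigO_one ℝ))

end Cesaro

/-! ### Fourth moments. -/

section Moments

variable {Ω : Type*} [MeasurableSpace Ω] {P : Measure Ω}

theorem memLp_four_and_integral_le {f : Ω → ℝ} (hf : Measurable f) {K : ℝ≥0∞} (hK : K ≠ ∞)
    (h : ∫⁻ ω, ‖f ω‖ₑ ^ (4 : ℝ) ∂P ≤ K) : MemLp f 4 P ∧ ∫ ω, f ω ^ 4 ∂P ≤ K.toReal := by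
  have h1 : MemLp f 4 P := by
    refine ⟨hf.aestronglyMeasurable, ?_⟩
    rw [eLpNorm_lt_top_iff_lintegral_rpow_enorm_lt_top (by norm_num) (by norm_num)]
    simpa using h.trans_lt hK.lt_top
  refine ⟨h1, ?_⟩
  rw [integral_eq_lintegral_of_nonneg_ae (ae_of_all _ fun ω => by positivity)
    (hf.pow_const 4).aestronglyMeasurable]
  refine ENNReal.toReal_mono hK (le_trans (le_of_eq (lintegral_congr fun ω => ?_)) h)
  rw [← Real.norm_of_nonneg (by positivity : 0 ≤ f ω ^ 4), ofReal_norm, enorm_pow,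
    ← ENNReal.rpow_natCast]
  norm_num

theorem integrable_pow_four {f : Ω → ℝ} (hf : MemLp f 4 P) : Integrable (fun ω => f ω ^ 4) P := by
  have := hf.integrable_norm_pow (p := 4) (by norm_num)
  refine this.congr (ae_of_all _ fun ω => ?_)
  simp only [Real.norm_eq_abs]
  exact Even.pow_abs (by decide) _

theorem memLp_two_mul {f g : Ω → ℝ} (hf : MemLp f 4 P) (hg : MemLp g 4 P) :
    MemLp (fun ω => f ω * g ω) 2 P := by
  have : ENNReal.HolderTriple 4 4 2 := ⟨by
    rw [show (4 : ℝ≥0∞) = 2 * 2 by norm_num, ENNReal.mul_inv (by simp) (by simp), ← two_mul,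
      ← mul_assoc, ENNReal.mul_inv_cancel (by simp) (by simp), one_mul]⟩
  exact hg.mul' hf

variable [IsProbabilityMeasure P]

theorem lintegral_enorm_rpow_four_le {f : Ω → ℝ} {r : ℝ} (hr : 2 ≤ r) :
    ∫⁻ ω, ‖f ω‖ₑ ^ (4 : ℝ) ∂P ≤ 1 + ∫⁻ ω, ‖f ω‖ₑ ^ (2 * r) ∂P := by
  have h1 : ∀ ω, ‖f ω‖ₑ ^ (4 : ℝ) ≤ 1 + ‖f ω‖ₑ ^ (2 * r) := fun ω => by
    rcases le_total ‖f ω‖ₑ 1 with h | h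
    · exact (ENNReal.rpow_le_one h (by norm_num)).trans le_self_add
    · exact (ENNReal.rpow_le_rpow_of_exponent_le h (by linarith)).trans le_add_self
  refine (lintegral_mono h1).trans ?_
  rw [lintegral_add_left measurable_const]
  simp

theorem variance_mul_le {f g : Ω → ℝ} (hf : MemLp f 4 P) (hg : MemLp g 4 P) {K : ℝ}
    (hfK : ∫ ω, f ω ^ 4 ∂P ≤ K) (hgK : ∫ ω, g ω ^ 4 ∂P ≤ K) :
    variance (fun ω => f ω * g ω) P ≤ K := by
  have hm := memLp_two_mul hf hg
  refine (variance_le_expectation_sq hm.1).trans ?_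
  have h1 : ∫ ω, (f ω * g ω) ^ 2 ∂P ≤ ∫ ω, (1 / 2 * f ω ^ 4 + 1 / 2 * g ω ^ 4) ∂P := by
    refine integral_mono hm.integrable_sq
      (((integrable_pow_four hf).const_mul _).add ((integrable_pow_four hg).const_mul _))
      fun ω => ?_
    simp only
    nlinarith [sq_nonneg (f ω ^ 2 - g ω ^ 2)]
  rw [integral_add ((integrable_pow_four hf).const_mul _) ((integrable_pow_four hg).const_mul _),
    integral_const_mul, integral_const_mul] at h1
  simp only [Pi.pow_apply]
  linarith

theorem integral_sq_le {f : Ω → ℝ} (hf : MemLp f 4 P) {K : ℝ} (hfK : ∫ ω, f ω ^ 4 ∂P ≤ K) :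
    ∫ ω, f ω ^ 2 ∂P ≤ 1 + K := by
  have h2 : MemLp f 2 P := hf.mono_exponent (by norm_num)
  have h1 : ∫ ω, f ω ^ 2 ∂P ≤ ∫ ω, (1 + f ω ^ 4) ∂P := by
    refine integral_mono h2.integrable_sq ((integrable_const _).add (integrable_pow_four hf))
      fun ω => ?_
    simp only
    nlinarith [sq_nonneg (f ω ^ 2 - 1), sq_nonneg (f ω ^ 2)]
  rw [integral_add (integrable_const _) (integrable_pow_four hf)] at h1
  simp at h1
  linarith

end Moments

/-! ### Positive definite limits and laws of large numbers for the model. -/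

section Model

theorem tendstoInProb_of_tendsto {Ω 𝕏 E : Type*} [MeasurableSpace Ω] [TopologicalSpace E]
    {P : Measure Ω} {Xh : ℕ → Ω → OnePoint 𝕏} {f : ℕ → Ω → 𝕏 → E} {y : E} {g : ℕ × Ω → 𝕏}
    (hg : ∀ᶠ p in probFilter P, Xh p.1 p.2 = (g p : OnePoint 𝕏))
    (hf : Tendsto (fun p => f p.1 p.2 (g p)) (probFilter P) (𝓝 y)) : TendstoInProb P Xh f y := by
  intro U hU
  have h : ∀ᶠ p in probFilter P, ∃ X : 𝕏, Xh p.1 p.2 = (X : OnePoint 𝕏) ∧ f p.1 p.2 X ∈ U :=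
    (hg.and (hf.eventually_mem hU)).mono fun p hp => ⟨g p, hp.1, hp.2⟩
  exact eventually_probFilter.1 h

theorem posDef_of_tendsto {ι : Type*} [Fintype ι] {A : ℕ → Matrix ι ι ℝ} {B : Matrix ι ι ℝ}
    (h : Tendsto A atTop (𝓝 B)) (hs : ∀ i, (A i).IsSymm) {k : ℝ} (hk : 0 < k)
    (hA : ∀ i v, k * (v ⬝ᵥ v) ≤ v ⬝ᵥ (A i *ᵥ v)) : B.PosDef := by
  refine posDef_of_quadForm_lower_bound ?_ hk fun v => ?_
  · have h1 : Tendsto (fun i => (A i)ᵀ) atTop (𝓝 Bᵀ) :=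
      (continuous_id.matrix_transpose.tendsto B).comp h
    exact tendsto_nhds_unique (h1.congr fun i => (hs i).eq) h
  · have hc : Continuous fun M : Matrix ι ι ℝ => v ⬝ᵥ (M *ᵥ v) := by fun_prop
    exact ge_of_tendsto' ((hc.tendsto B).comp h) fun i => hA i v

theorem one_div_smul_gram {n : ℕ} (m : ℕ) (a : ℕ → Fin n → ℝ) :
    (1 / (m : ℝ)) • ((rowMatrix m a)ᵀ * rowMatrix m a) =
      avg m fun i => Matrix.vecMulVec (a i) (a i) := by
  ext p q
  rw [avg_apply, Matrix.smul_apply, Matrix.mul_apply, mean, ← Fin.sum_univ_eq_sum_range]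
  simp [rowMatrix, Matrix.vecMulVec_apply]

/-- Limits of Gram averages are positive semidefinite, and an invertible positive semidefinite
matrix is positive definite. -/
theorem posDef_of_tendsto_gram {n : ℕ} {a : ℕ → Fin n → ℝ} {V : Matrix (Fin n) (Fin n) ℝ}
    (h : Tendsto (fun m => avg m fun i => Matrix.vecMulVec (a i) (a i)) atTop (𝓝 V))
    (hV : IsUnit V) : V.PosDef := by
  have hs : V.IsSymm := by
    have h1 : Tendsto (fun m => (avg m fun i => Matrix.vecMulVec (a i) (a i))ᵀ) atTop (𝓝 Vᵀ) :=
      (continuous_id.matrix_transpose.tendsto V).comp h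
    refine tendsto_nhds_unique (h1.congr fun m => ?_) h
    ext p q
    simp [avg_apply, Matrix.vecMulVec_apply, mul_comm]
  have hps : V.PosSemidef := by
    refine Matrix.PosSemidef.of_dotProduct_mulVec_nonneg
      (by simpa [Matrix.IsHermitian] using hs.eq) fun v => ?_
    have hc : Continuous fun M : Matrix (Fin n) (Fin n) ℝ => v ⬝ᵥ (M *ᵥ v) := by fun_prop
    rw [star_trivial]
    refine ge_of_tendsto' ((hc.tendsto V).comp h) fun m => ?_
    rw [Function.comp_apply, dotProduct_avg_mulVec]
    exact mean_nonneg fun i => mul_self_nonneg _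
  exact hps.posDef_iff_isUnit.2 hV

variable {Ω : Type*} [MeasurableSpace Ω] {P : Measure Ω} {n d : ℕ}
  {e : ℕ → Ω → (Fin n ⊕ Fin d → ℝ)} {J : Finset (Fin n ⊕ Fin d)} {Sig : ℕ → Matrix J J ℝ} {σ : ℝ}

theorem scaledCov_eq_extendZero (hσ : 0 < σ) (he_ae : ∀ i, ∀ j ∉ J, ∀ᵐ ω ∂P, e i ω j = 0)
    (he_cov : ∀ i (p q : J),
      covariance (fun ω => e i ω p) (fun ω => e i ω q) P = σ ^ 2 * Sig i p q) (i : ℕ) :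
    scaledCov P σ e i = extendZero (Sig i) := by
  have h0 : ∀ p ∉ J, ∀ Y : Ω → ℝ, covariance (fun ω => e i ω p) Y P = 0 := by
    intro p hp Y
    have h1 : ∫ ω, e i ω p ∂P = 0 := integral_eq_zero_of_ae (he_ae i p hp)
    rw [covariance]
    refine integral_eq_zero_of_ae ?_
    filter_upwards [he_ae i p hp] with ω hω
    simp [hω, h1]
  ext p q
  simp only [scaledCov, extendZero, Matrix.of_apply]
  split_ifs with h
  · have := he_cov i ⟨p, h.1⟩ ⟨q, h.2⟩
    simp only at this
    rw [this]
    field_simp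
  · rw [not_and_or] at h
    rcases h with h | h
    · rw [h0 p h, mul_zero]
    · rw [covariance_comm, h0 q h, mul_zero]

variable [IsProbabilityMeasure P]

theorem tendsto_mean_error_mul_error (he_indep : iIndepFun e P)
    (he_mean : ∀ i j, ∫ ω, e i ω j ∂P = 0)
    (he_cov : ∀ i (p q : J),
      covariance (fun ω => e i ω p) (fun ω => e i ω q) P = σ ^ 2 * Sig i p q)
    {M : Matrix J J ℝ} (hSigM : Tendsto Sig atTop (𝓝 M)) {K : ℝ}
    (hK : ∀ i (j : J), MemLp (fun ω => e i ω j) 4 P ∧ ∫ ω, e i ω j ^ 4 ∂P ≤ K) (p q : J) :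
    Tendsto (fun s : ℕ × Ω => mean s.1 fun i => e i s.2 p * e i s.2 q) (probFilter P)
      (𝓝 (σ ^ 2 * M p q)) := by
  have h1 := tendsto_mean_sub_mean_integral (P := P) (X := fun i ω => e i ω p * e i ω q)
    (fun i => memLp_two_mul (hK i p).1 (hK i q).1)
    (fun i j hij => (he_indep.indepFun hij).comp
      (φ := fun v : Fin n ⊕ Fin d → ℝ => v p * v q) (ψ := fun v : Fin n ⊕ Fin d → ℝ => v p * v q)
      (by fun_prop) (by fun_prop))
    (fun i => variance_mul_le (hK i p).1 (hK i q).1 (hK i p).2 (hK i q).2)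
    (by
      simpa using tendsto_one_div_atTop_nhds_zero_nat.mul
        (tendsto_mean (tendsto_const_nhds (x := K))))
  have h2 : ∀ i, ∫ ω, e i ω p * e i ω q ∂P = σ ^ 2 * Sig i p q := fun i => by
    rw [← he_cov, covariance_eq_sub ((hK i p).1.mono_exponent (by norm_num))
      ((hK i q).1.mono_exponent (by norm_num)), he_mean, zero_mul, sub_zero]
    rfl
  simp_rw [h2] at h1
  have h3 := (tendsto_mean ((tendsto_matrix_iff.1 hSigM p q).const_mul (σ ^ 2))).comp
    (tendsto_fst_probFilter (P := P))
  simpa [Function.comp_def] using h1.add h3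

/-- The summands have variance at most `(1 + K) b i ^ 2`. The averages of these bounds converge, so
the further factor `1 / m` makes the variance of the mean vanish. -/
theorem tendsto_mean_signal_mul_error (he_indep : iIndepFun e P)
    (he_mean : ∀ i j, ∫ ω, e i ω j ∂P = 0) {b : ℕ → ℝ} {l : ℝ}
    (hb : Tendsto (fun m => mean m fun i => b i * b i) atTop (𝓝 l)) {K : ℝ}
    (hK : ∀ i (j : J), MemLp (fun ω => e i ω j) 4 P ∧ ∫ ω, e i ω j ^ 4 ∂P ≤ K) (q : J) :
    Tendsto (fun s : ℕ × Ω => mean s.1 fun i => b i * e i s.2 q) (probFilter P) (𝓝 0) := by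
  have h2 : ∀ i, MemLp (fun ω => e i ω q) 2 P := fun i =>
    (hK i q).1.mono_exponent (by norm_num)
  have h1 := tendsto_mean_sub_mean_integral (P := P) (X := fun i ω => b i * e i ω q)
    (fun i => (h2 i).const_mul _)
    (fun i j hij => (he_indep.indepFun hij).comp
      (φ := fun v : Fin n ⊕ Fin d → ℝ => b i * v q) (ψ := fun v : Fin n ⊕ Fin d → ℝ => b j * v q)
      (by fun_prop) (by fun_prop))
    (v := fun i => (1 + K) * (b i * b i))
    (fun i => by
      rw [variance_const_mul, mul_comm, sq]
      exact mul_le_mul_of_nonneg_right ((variance_le_expectation_sq (h2 i).1).trans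
        (integral_sq_le (hK i q).1 (hK i q).2)) (mul_self_nonneg _))
    (by
      simp_rw [mean_const_mul]
      simpa using tendsto_one_div_atTop_nhds_zero_nat.mul (hb.const_mul (1 + K)))
  have h3 : ∀ m, mean m (fun i => ∫ ω, b i * e i ω q ∂P) = 0 := fun m => by
    simp [integral_const_mul, he_mean, mean]
  simpa [h3] using h1

theorem tendsto_mean_mul_error_sq {ε : ℕ → ℝ} (hε0 : ∀ i, 0 ≤ ε i) (hε : Tendsto ε atTop (𝓝 0))
    {K : ℝ} (hK : ∀ i (j : J), MemLp (fun ω => e i ω j) 4 P ∧ ∫ ω, e i ω j ^ 4 ∂P ≤ K) :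
    Tendsto (fun s : ℕ × Ω => mean s.1 fun i =>
      ε i * (restr J (fun i => e i s.2) i ⬝ᵥ restr J (fun i => e i s.2) i)) (probFilter P)
      (𝓝 0) := by
  have h1 : ∀ q : J, Tendsto (fun s : ℕ × Ω => mean s.1 fun i => ε i * e i s.2 q ^ 2)
      (probFilter P) (𝓝 0) := by
    intro q
    refine tendsto_mean_of_nonneg (X := fun i ω => ε i * e i ω q ^ 2)
      (fun i ω => mul_nonneg (hε0 i) (sq_nonneg _))
      (fun i => ((hK i q).1.mono_exponent (by norm_num)).integrable_sq.const_mul _) ?_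
    have h2 := (tendsto_mean hε).const_mul (1 + K)
    rw [mul_zero] at h2
    refine squeeze_zero (fun m => mean_nonneg fun i => integral_nonneg fun ω =>
      mul_nonneg (hε0 i) (sq_nonneg _)) (fun m => ?_) h2
    rw [← mean_const_mul]
    refine mean_le_mean fun i _ => ?_
    rw [integral_const_mul, mul_comm (1 + K)]
    exact mul_le_mul_of_nonneg_left (integral_sq_le (hK i q).1 (hK i q).2) (hε0 i)
  have h3 := tendsto_finsetSum Finset.univ fun q (_ : q ∈ Finset.univ) => h1 q
  simp only [Finset.sum_const_zero] at h3
  refine h3.congr fun s => ?_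
  rw [← mean_sum (f := fun (q : J) i => ε i * e i s.2 q ^ 2)]
  congr 1
  funext i
  rw [dotProduct_self_eq_sum_sq, Finset.mul_sum]
  rfl

end Model

end

end EWTLS

/-! ### The theorem: assembling the stochastic limits and consistency. -/

open EWTLS in
theorem lemma8 {Ω : Type*} [MeasurableSpace Ω] (P : Measure Ω) [IsProbabilityMeasure P]
    {n d : ℕ} (hd : 1 ≤ d)
    (X₀ : Matrix (Fin n) (Fin d) ℝ)
    (a₀ : ℕ → Fin n → ℝ)
    (e : ℕ → Ω → (Fin n ⊕ Fin d → ℝ))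
    (J : Finset (Fin n ⊕ Fin d)) (Sig : ℕ → Matrix J J ℝ) (σ : ℝ) (hσ : 0 < σ)
    -- independent centred error vectors with finite second moments
    (he_meas : ∀ i, Measurable (e i))
    (he_indep : iIndepFun e P)
    (he_sq : ∀ i j, MemLp (fun ω => e i ω j) 2 P)
    (he_mean : ∀ i j, ∫ ω, e i ω j ∂P = 0)
    -- error-free columns outside `J`, covariance `σ² Σ_i` on `J`
    (he_zero : ∀ i, ∀ j ∉ J, ∫ ω, (e i ω j) ^ 2 ∂P = 0)
    (he_cov : ∀ i (p q : J),
      covariance (fun ω => e i ω p) (fun ω => e i ω q) P = σ ^ 2 * Sig i p q)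
    -- smallest eigenvalues of `Σ_i` bounded below
    (hSig : ∃ κ : ℝ, 0 < κ ∧ ∀ i, ∀ t ∈ spectrum ℝ (Sig i), κ ^ 2 ≤ t)
    -- full rank of the rows of `Z₀` with index in `J`
    (hrank : (ZJ J X₀).rank = d)
    -- moments of order `2r`
    (hmom : ∃ r : ℝ, 2 ≤ r ∧ (d : ℝ) * ((J.card : ℝ) - ((d : ℝ) + 1) / 2) < r ∧
      (⨆ (i : ℕ) (j : J), ∫⁻ ω, ‖e i ω j‖ₑ ^ (2 * r) ∂P) < ∞)
    -- moments of order `4 + 2δ` and the growth of the true inputs, with the same `δ`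
    (hδ : ∃ δ : ℝ, 0 < δ ∧
      (⨆ (i : ℕ) (j : J), ∫⁻ ω, ‖e i ω j‖ₑ ^ (4 + 2 * δ) ∂P) < ∞ ∧
      Tendsto (fun m : ℕ => (1 / (m : ℝ) ^ (1 + δ / 2)) *
        ∑ i ∈ Finset.range m, ‖WithLp.toLp 2 (a₀ i)‖ ^ (2 + δ)) atTop (𝓝 0))
    -- `m⁻¹ A₀ᵀ A₀` tends to a nonsingular matrix
    (VA : Matrix (Fin n) (Fin n) ℝ)
    (hVA : Tendsto (fun m : ℕ => (1 / (m : ℝ)) • ((rowMatrix m a₀)ᵀ * rowMatrix m a₀))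
      atTop (𝓝 VA))
    (hVA_unit : IsUnit VA)
    -- `Σ_i` converges
    (hSig_lim : ∃ SigInf : Matrix J J ℝ, Tendsto Sig atTop (𝓝 SigInf))
    -- vanishing third moments
    (hthird : ∀ i (p q r : J), ∫ ω, e i ω p * e i ω q * e i ω r ∂P = 0)
    -- convergence of the averaged fourth moments
    (hfourth : ∀ p q r u : J, ∃ μ₄ : ℝ, Tendsto (fun m : ℕ => (1 / (m : ℝ)) *
      ∑ i ∈ Finset.range m, ∫ ω, e i ω p * e i ω q * e i ω r * e i ω u ∂P) atTop (𝓝 μ₄))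
    -- the estimator, for each number `m` of observations
    (Xhat : ∀ m : ℕ,
      Matrix (Fin m) (Fin n ⊕ Fin d) ℝ → OnePoint (Matrix (Fin n) (Fin d) ℝ))
    (hXhat : ∀ m, IsEstimator J Sig (Xhat m)) :
    TendstoInProb P (fun m ω => Xhat m (rowMatrix m (obs X₀ a₀ e ω)))
        (fun m ω X => sigmaSq m (obs X₀ a₀ e ω) (scaledCov P σ e) X) (σ ^ 2) ∧
      TendstoInProb P (fun m ω => Xhat m (rowMatrix m (obs X₀ a₀ e ω)))
        (fun m ω X => vA m (obs X₀ a₀ e ω) (scaledCov P σ e) X) VA := by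
  obtain ⟨κ, hκ, hSigκ⟩ := hSig
  obtain ⟨M, hSigM⟩ := hSig_lim
  obtain ⟨r, hr, -, hsup⟩ := hmom
  have hsymm : ∀ i, (Sig i).IsSymm := fun i => by
    ext p q
    have h1 := he_cov i q p
    rw [covariance_comm, he_cov i p q] at h1
    exact (mul_left_cancel₀ (by positivity) h1).symm
  have hlow : ∀ i v, κ ^ 2 * (v ⬝ᵥ v) ≤ v ⬝ᵥ (Sig i *ᵥ v) := fun i v =>
    quadForm_lower_bound_of_spectrum (hsymm i) (hSigκ i) v
  have hSigP : ∀ i, (Sig i).PosDef := fun i =>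
    posDef_of_quadForm_lower_bound (hsymm i) (by positivity) (hlow i)
  have hM : M.PosDef := posDef_of_tendsto hSigM hsymm (by positivity) hlow
  simp_rw [one_div_smul_gram] at hVA
  have hV := posDef_of_tendsto_gram hVA hVA_unit
  have he_ae : ∀ i, ∀ j ∉ J, ∀ᵐ ω ∂P, e i ω j = 0 := fun i j hj => by
    have h1 := (integral_eq_zero_iff_of_nonneg (fun ω => sq_nonneg (e i ω j))
      (he_sq i j).integrable_sq).1 (he_zero i j hj)
    filter_upwards [h1] with ω hω
    exact pow_eq_zero_iff two_ne_zero |>.1 hω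
  obtain ⟨K, hK⟩ : ∃ K : ℝ, ∀ i (j : J),
      MemLp (fun ω => e i ω j) 4 P ∧ ∫ ω, e i ω j ^ 4 ∂P ≤ K := by
    refine ⟨_, fun i j => memLp_four_and_integral_le (by fun_prop)
      (ENNReal.add_ne_top.2 ⟨ENNReal.one_ne_top, hsup.ne⟩)
      ((lintegral_enorm_rpow_four_le hr).trans (add_le_add_right ?_ 1))⟩
    exact le_iSup₂ (f := fun i (j : J) => ∫⁻ ω, ‖e i ω j‖ₑ ^ (2 * r) ∂P) i j
  set x : ℕ × Ω → ℕ → Fin n ⊕ Fin d → ℝ := fun s i => e i s.2 with hxdef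
  have hx : ∀ᶠ s in probFilter P, ∀ i, ∀ j ∉ J, x s i j = 0 :=
    eventually_probFilter_of_ae (Q := fun ω => ∀ i, ∀ j ∉ J, e i ω j = 0)
      (ae_all_iff.2 fun i => ae_all_iff.2 fun j => by
        by_cases hj : j ∈ J
        · simp [hj]
        · simpa [hj] using he_ae i j hj)
  have hA := hVA.comp (tendsto_fst_probFilter (P := P))
  have hVA' : ∀ k, Tendsto (fun m => mean m fun i => a₀ i k * a₀ i k) atTop (𝓝 (VA k k)) :=
    fun k => by simpa [avg_apply, Matrix.vecMulVec_apply] using tendsto_matrix_iff.1 hVA k k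
  have hB : Tendsto (fun s : ℕ × Ω => avg s.1 fun i =>
      Matrix.vecMulVec (a₀ i) (restr J (x s) i)) (probFilter P) (𝓝 0) :=
    tendsto_matrix_iff.2 fun k q => by
      simpa [avg_apply, Matrix.vecMulVec_apply, restr] using
        tendsto_mean_signal_mul_error he_indep he_mean (hVA' k) hK q
  have hE : Tendsto (fun s : ℕ × Ω => avg s.1 fun i =>
      Matrix.vecMulVec (restr J (x s) i) (restr J (x s) i)) (probFilter P) (𝓝 (σ ^ 2 • M)) :=
    tendsto_matrix_iff.2 fun p q => by
      simpa [avg_apply, Matrix.vecMulVec_apply, restr] using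
        tendsto_mean_error_mul_error he_indep he_mean he_cov hSigM hK p q
  have hεa : ∀ ε : ℕ → ℝ, (∀ i, 0 ≤ ε i) → Tendsto ε atTop (𝓝 0) →
      Tendsto (fun s : ℕ × Ω => mean s.1 fun i => ε i * (a₀ i ⬝ᵥ a₀ i)) (probFilter P) (𝓝 0) := by
    intro ε _ hε
    have h1 : Tendsto (fun m => mean m fun i => a₀ i ⬝ᵥ a₀ i) atTop (𝓝 (∑ k, VA k k)) := by
      refine (tendsto_finsetSum Finset.univ fun k _ => hVA' k).congr fun m => ?_
      rw [← mean_sum (f := fun k i => a₀ i k * a₀ i k)]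
      rfl
    exact (tendsto_mean_mul_zero hε (fun i => dotProduct_self_nonneg' _) h1).comp
      tendsto_fst_probFilter
  have hsol : ∀ U ∈ 𝓝 X₀, ∀ᶠ s in probFilter P,
      ∃ X ∈ U, Xhat s.1 (rowMatrix s.1 (obs X₀ a₀ e s.2)) =
        (X : OnePoint (Matrix (Fin n) (Fin d) ℝ)) := by
    intro U hU
    filter_upwards [eventually_exists_solves_and_mem hSigP hM hSigM hV hrank σ hx hA hB hE hεa
      (fun ε hε0 hε => tendsto_mean_mul_error_sq hε0 hε hK) hU] with s hs
    -- The value `∞` would contradict solvability, so the estimator returns a solution, and every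
    -- solution lies in `U`.
    rcases OnePoint.ne_infty_iff_exists.1 fun h => (hXhat s.1).infty _ h hs.1 with ⟨X, hX⟩
    exact ⟨X, hs.2 X ((hXhat s.1).solves _ X hX.symm), hX.symm⟩
  classical
  -- `g` is the finite part of the estimator. The default `X₀` is used only where the estimator is
  -- `∞`, an event whose probability tends to zero.
  set g : ℕ × Ω → Matrix (Fin n) (Fin d) ℝ := fun s =>
    if h : ∃ X : Matrix (Fin n) (Fin d) ℝ, Xhat s.1 (rowMatrix s.1 (obs X₀ a₀ e s.2)) =
      (X : OnePoint (Matrix (Fin n) (Fin d) ℝ)) then h.choose else X₀ with hg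
  have hgX : ∀ s (X : Matrix (Fin n) (Fin d) ℝ), Xhat s.1 (rowMatrix s.1 (obs X₀ a₀ e s.2)) =
      (X : OnePoint (Matrix (Fin n) (Fin d) ℝ)) → g s = X := by
    intro s X hX
    have h : ∃ X : Matrix (Fin n) (Fin d) ℝ, Xhat s.1 (rowMatrix s.1 (obs X₀ a₀ e s.2)) =
      (X : OnePoint (Matrix (Fin n) (Fin d) ℝ)) := ⟨X, hX⟩
    simp only [hg, dif_pos h]
    exact OnePoint.coe_injective (h.choose_spec.symm.trans hX)
  have hgeq : ∀ᶠ s in probFilter P, Xhat s.1 (rowMatrix s.1 (obs X₀ a₀ e s.2)) =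
      (g s : OnePoint (Matrix (Fin n) (Fin d) ℝ)) := by
    filter_upwards [hsol Set.univ univ_mem] with s ⟨X, _, hX⟩
    rw [hgX s X hX, hX]
  have hglim : Tendsto g (probFilter P) (𝓝 X₀) := by
    refine tendsto_def.2 fun U hU => ?_
    filter_upwards [hsol U hU] with s ⟨X, hXU, hX⟩
    rw [Set.mem_preimage, hgX s X hX]
    exact hXU
  have hc : Tendsto (fun s : ℕ × Ω => avg s.1 fun i =>
      Matrix.vecMulVec (obs X₀ a₀ e s.2 i) (obs X₀ a₀ e s.2 i)) (probFilter P)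
      (𝓝 (signalGram X₀ VA + σ ^ 2 • extendZero M)) := tendsto_avg_noisyRows X₀ hx hA hB hE
  have hS : Tendsto (fun s : ℕ × Ω => avg s.1 (scaledCov P σ e)) (probFilter P)
      (𝓝 (extendZero M)) := by
    have h1 : scaledCov P σ e = fun i => extendZero (Sig i) :=
      funext (scaledCov_eq_extendZero hσ he_ae he_cov)
    rw [h1, tendsto_matrix_iff]
    intro p q
    simp_rw [avg_apply]
    refine (tendsto_mean ?_).comp tendsto_fst_probFilter
    simp only [extendZero, Matrix.of_apply]
    split_ifs with h
    · exact tendsto_matrix_iff.1 hSigM _ _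
    · exact tendsto_const_nhds
  have hsig := tendsto_sigmaSq hM hd hrank σ hc hS hglim
  exact ⟨tendstoInProb_of_tendsto hgeq hsig, tendstoInProb_of_tendsto hgeq (tendsto_vA hc hS hsig)⟩
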